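/- Let $K<G$ be compact Lie groups with Lie algebras $\mathfrak k\subset\mathfrak g$, where $G$ is simple. Let $Q$ be minus the Killing form of $\mathfrak g$, let $\mathfrak a=\mathfrak k^{\perp}$ be the $Q$-orthogonal complement of $\mathfrak k$, and assume that $\mathrm{Ad}(K)$ acts irreducibly on $\mathfrak a$ (in particular $\mathfrak a\neq 0$). Fix a $Q$-orthogonal decomposition $\mathcal D$: $$\mathfrak k=\mathfrak k_1\oplus\cdots\oplus\mathfrak k_{r+s},$$ where $\mathfrak k_1,\dots,\mathfrak k_r$ are simple ideals of $\mathfrak k$ and $\mathfrak k_{r+1},\dots,\mathfrak k_{r+s}$ are one-dimensional subspaces whose sum is the centre of $\mathfrak k$. Put $d=\dim\mathfrak g$, $d_i=\dim\mathfrak k_i$, and let $\kappa_i$ be the constant such that the Killing form of $\mathfrak k_i$ equals $-\kappa_i\,Q|_{\mathfrak k_i}$ (so $\kappa_i=0$ for $i>r$). Identify left-invariant metrics on $G$ with inner products on $\mathfrak g$, and let $\mathcal M_K^{\mathcal D}$ be the set of (naturally reductive) left-invariant metrics of the form $$g=\alpha\,Q|_{\mathfrak a}+\alpha_1Q|_{\mathfrak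 k_1}+\cdots+\alpha_{r+s}Q|_{\mathfrak k_{r+s}},\qquad \alpha,\alpha_1,\dots,\alpha_{r+s}>0 .$$ Let $T=T_{\mathfrak a}Q|_{\mathfrak a}+T_1Q|_{\mathfrak k_1}+\cdots+T_{r+s}Q|_{\mathfrak k_{r+s}}\in\mathcal M_K^{\mathcal D}$, and let $\mathcal M_{K,T}^{\mathcal D}=\{g\in\mathcal M_K^{\mathcal D}:\operatorname{tr}_gT=1\}$. Choose an index $m\in\{1,\dots,r+s\}$ with $\kappa_m/T_m=\max_{1\le i\le r+s}\kappa_i/T_i$ (if $r\ge 1$, this is the same as choosing $m\in\{1,\dots,r\}$ with $\kappa_m/T_m=\max_{1\le i\le r}\kappa_i/T_i$). Suppose that $$\frac{\kappa_m\operatorname{tr}_QT}{T_m}<d+d_m-\kappa_md_m .$$ Then the scalar curvature functional $g\mapsto S_g$ restricted to $\mathcal M_{K,T}^{\mathcal D}$ attains its global maximum at some $g_{\max}\in\mathcal M_{K,T}^{\mathcal D}$. If moreover $\mathrm{Ad}(K)$ preserves each $\mathfrak k_i$ (that is, every metric in $\mathcal M_K^{\mathcal D}$ is invariant under right translations by $K$;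 this is automatic when $K$ is connected), then every such maximiser $g_{\max}$ satisfies $\mathrm{Ric}_{g_{\max}}=cT$ for some constant $c>0$. -/

import Mathlib

open scoped Manifold ContDiff

noncomputable section

namespace NaturallyReductive

/-! ### Left-invariant metrics on a Lie group, in terms of its Lie algebra -/

section Algebra

variable {𝔤 : Type*} [LieRing 𝔤] [LieAlgebra ℝ 𝔤]

/-- A left-invariant Riemannian metric on a Lie group with Lie algebra `𝔤`, identified as usual
with the inner product that it induces on `𝔤`. -/
@[ext]
structure LeftInvMetric (𝔤 : Type*) [LieRing 𝔤] [LieAlgebra ℝ 𝔤] where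
  form : LinearMap.BilinForm ℝ 𝔤
  symm : ∀ X Y, form X Y = form Y X
  pos : ∀ X, X ≠ 0 → 0 < form X X

theorem LeftInvMetric.nondegenerate (g : LeftInvMetric 𝔤) : g.form.Nondegenerate := by
  constructor
  · intro X hX
    by_contra h
    exact (g.pos X h).ne' (hX X)
  · intro X hX
    by_contra h
    exact (g.pos X h).ne' (hX X)

/-- The trace of a bilinear form `T` with respect to a nondegenerate bilinear form `B`: the trace
of the endomorphism `A` with `B (A X) Y = T X Y`. -/
def traceWrt [FiniteDimensional ℝ 𝔤] (B : LinearMap.BilinForm ℝ 𝔤) (hB : B.Nondegenerate)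
    (T : LinearMap.BilinForm ℝ 𝔤) : ℝ :=
  LinearMap.trace ℝ 𝔤 ((B.toDual hB).symm.toLinearMap ∘ₗ T)

namespace LeftInvMetric

variable (g : LeftInvMetric 𝔤)

/-- The right-hand side of the Koszul formula for left-invariant fields `X`, `Y`, `Z` (on which
`g` is constant), as a linear form in `Z`:
`½ (g([X,Y],Z) - g([Y,Z],X) + g([Z,X],Y))`. -/
def koszul (X Y : 𝔤) : Module.Dual ℝ 𝔤 :=
  (1 / 2 : ℝ) • (g.form ⁅X, Y⁆ - g.form X ∘ₗ (LieAlgebra.ad ℝ 𝔤 Y)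
    - g.form Y ∘ₗ (LieAlgebra.ad ℝ 𝔤 X))

theorem koszul_apply (X Y Z : 𝔤) :
    g.koszul X Y Z = 1 / 2 * (g.form ⁅X, Y⁆ Z - g.form ⁅Y, Z⁆ X + g.form ⁅Z, X⁆ Y) := by
  simp only [koszul, LinearMap.smul_apply, LinearMap.sub_apply, LinearMap.comp_apply,
    LieAlgebra.ad_apply, smul_eq_mul]
  rw [← lie_skew X Z, g.symm ⁅Y, Z⁆ X, map_neg, g.symm ⁅Z, X⁆ Y]
  ring

variable [FiniteDimensional ℝ 𝔤]

/-- The Levi-Civita connection of `g` on left-invariant vector fields: `∇_X Y` is the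
left-invariant field determined by the Koszul formula. -/
def nabla : 𝔤 →ₗ[ℝ] 𝔤 →ₗ[ℝ] 𝔤 :=
  LinearMap.mk₂ ℝ (fun X Y => (g.form.toDual g.nondegenerate).symm (g.koszul X Y))
    (by
      intro X X' Y
      rw [← map_add]; congr 1; ext Z
      simp only [LinearMap.add_apply, koszul_apply, add_lie, lie_add, map_add]; ring)
    (by
      intro c X Y
      rw [← map_smul]; congr 1; ext Z
      simp only [LinearMap.smul_apply, koszul_apply, smul_lie, lie_smul, map_smul, smul_eq_mul]
      ring)
    (by
      intro X Y Y'
      rw [← map_add]; congr 1; ext Z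
      simp only [LinearMap.add_apply, koszul_apply, add_lie, lie_add, map_add]; ring)
    (by
      intro c X Y
      rw [← map_smul]; congr 1; ext Z
      simp only [LinearMap.smul_apply, koszul_apply, smul_lie, lie_smul, map_smul, smul_eq_mul]
      ring)

theorem form_nabla (X Y Z : 𝔤) :
    g.form (g.nabla X Y) Z = 1 / 2 * (g.form ⁅X, Y⁆ Z - g.form ⁅Y, Z⁆ X + g.form ⁅Z, X⁆ Y) := by
  rw [← koszul_apply]
  exact LinearMap.congr_fun ((g.form.toDual g.nondegenerate).apply_symm_apply (g.koszul X Y)) Z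

/-- The connection is metric (`g` is constant on left-invariant fields). -/
theorem nabla_metric (X Y Z : 𝔤) : g.form (g.nabla X Y) Z + g.form Y (g.nabla X Z) = 0 := by
  rw [g.symm Y, form_nabla, form_nabla, ← lie_skew Z Y, ← lie_skew Z X, ← lie_skew Y X]
  simp only [map_neg, LinearMap.neg_apply]
  ring

/-- The connection is torsion-free. -/
theorem nabla_torsion (X Y : 𝔤) : g.nabla X Y - g.nabla Y X = ⁅X, Y⁆ := by
  rw [← sub_eq_zero]
  apply g.nondegenerate.1
  intro Z
  simp only [map_sub, LinearMap.sub_apply, form_nabla]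
  rw [← lie_skew Y X, ← lie_skew Z Y, ← lie_skew Z X]
  simp only [map_neg, LinearMap.neg_apply]
  ring

/-- The curvature endomorphism `R(X,Y) = ∇_X ∇_Y - ∇_Y ∇_X - ∇_[X,Y]`. -/
def curvature (X Y : 𝔤) : Module.End ℝ 𝔤 :=
  g.nabla X ∘ₗ g.nabla Y - g.nabla Y ∘ₗ g.nabla X - g.nabla ⁅X, Y⁆

/-- The linear map `X ↦ R(X,Y)Z`. -/
def curvatureLeft (Y Z : 𝔤) : Module.End ℝ 𝔤 where
  toFun X := g.curvature X Y Z
  map_add' X X' := by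
    simp only [curvature, add_lie, map_add, LinearMap.sub_apply, LinearMap.add_apply,
      LinearMap.comp_apply]
    abel
  map_smul' c X := by
    simp only [curvature, smul_lie, map_smul, LinearMap.sub_apply, LinearMap.smul_apply,
      LinearMap.comp_apply, RingHom.id_apply, smul_sub]

/-- The Ricci curvature `Ric(Y,Z) = tr (X ↦ R(X,Y)Z)`. -/
def ricci : LinearMap.BilinForm ℝ 𝔤 :=
  LinearMap.mk₂ ℝ (fun Y Z => LinearMap.trace ℝ 𝔤 (g.curvatureLeft Y Z))
    (by
      intro Y Y' Z
      rw [← map_add]; congr 1; ext X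
      simp only [curvatureLeft, curvature, LinearMap.coe_mk, AddHom.coe_mk, lie_add, map_add,
        LinearMap.sub_apply, LinearMap.add_apply, LinearMap.comp_apply]
      abel)
    (by
      intro c Y Z
      rw [← map_smul]; congr 1; ext X
      simp only [curvatureLeft, curvature, LinearMap.coe_mk, AddHom.coe_mk, lie_smul, map_smul,
        LinearMap.sub_apply, LinearMap.smul_apply, LinearMap.comp_apply, smul_sub])
    (by
      intro Y Z Z'
      rw [← map_add]; congr 1; ext X
      simp only [curvatureLeft, LinearMap.coe_mk, AddHom.coe_mk, map_add, LinearMap.add_apply])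
    (by
      intro c Y Z
      rw [← map_smul]; congr 1; ext X
      simp only [curvatureLeft, LinearMap.coe_mk, AddHom.coe_mk, map_smul, LinearMap.smul_apply])

/-- The trace `tr_g T`. -/
def tr (T : LinearMap.BilinForm ℝ 𝔤) : ℝ := traceWrt g.form g.nondegenerate T

/-- The scalar curvature `S_g = tr_g Ric_g`. -/
def scalarCurvature : ℝ := g.tr g.ricci

end LeftInvMetric

/-! ### The background form and the class of diagonal metrics -/

/-- The background form `Q`: minus the Killing form. -/
def Q (𝔤 : Type*) [LieRing 𝔤] [LieAlgebra ℝ 𝔤] : LinearMap.BilinForm ℝ 𝔤 := -killingForm ℝ 𝔤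

theorem Q_nondegenerate [FiniteDimensional ℝ 𝔤] [LieAlgebra.IsSimple ℝ 𝔤] :
    (Q 𝔤).Nondegenerate := by
  have h := LieAlgebra.IsKilling.killingForm_nondegenerate ℝ 𝔤
  constructor
  · intro X hX
    exact h.1 X fun Y => by simpa [Q] using hX Y
  · intro X hX
    exact h.2 X fun Y => by simpa [Q] using hX Y

/-- The trace `tr_Q T` with respect to the background form. -/
def trQ [FiniteDimensional ℝ 𝔤] [LieAlgebra.IsSimple ℝ 𝔤] (T : LinearMap.BilinForm ℝ 𝔤) : ℝ :=
  traceWrt (Q 𝔤) Q_nondegenerate T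

/-- The `Q`-orthogonal complement `𝔞` of `𝔨` in `𝔤`. -/
def orthCompl (𝔨 : Submodule ℝ 𝔤) : Submodule ℝ 𝔤 := (Q 𝔤).orthogonal 𝔨

/-- The constant `κ` of a subalgebra `𝔥` whose Killing form is a multiple of `Q` restricted to
`𝔥`: the number with `B_𝔥 = -κ Q|_𝔥`. -/
def kappa (𝔥 : LieSubalgebra ℝ 𝔤) : ℝ :=
  Classical.epsilon fun c : ℝ => ∀ X Y : 𝔥, killingForm ℝ 𝔥 X Y = -c * Q 𝔤 X Y

/-- A `Q`-orthogonal decomposition `𝔨 = 𝔷(𝔨) ⊕ 𝔨_1 ⊕ ⋯ ⊕ 𝔨_r`, with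
`𝔷(𝔨) = 𝔨_{r+1} ⊕ ⋯ ⊕ 𝔨_{r+s}`, of a subspace (in practice, a subalgebra) `𝔨` of `𝔤`: the summands
`part (Sum.inl i)` are simple ideals of `𝔨` and the summands `part (Sum.inr j)` are lines in the
centre of `𝔨`. -/
structure Splitting (𝔨 : Submodule ℝ 𝔤) (r s : ℕ) where
  part : Fin r ⊕ Fin s → LieSubalgebra ℝ 𝔤
  simple : ∀ i : Fin r, LieAlgebra.IsSimple ℝ (part (Sum.inl i))
  ideal : ∀ i : Fin r, ∀ X ∈ 𝔨, ∀ Y ∈ part (Sum.inl i), ⁅X, Y⁆ ∈ part (Sum.inl i)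
  line : ∀ j : Fin s, Module.finrank ℝ (part (Sum.inr j)) = 1
  central : ∀ j : Fin s, ∀ X ∈ 𝔨, ∀ Y ∈ part (Sum.inr j), ⁅X, Y⁆ = 0
  orthogonal : ∀ i j, i ≠ j → ∀ X ∈ part i, ∀ Y ∈ part j, Q 𝔤 X Y = 0
  iSup_eq : (⨆ i, (part i).toSubmodule) = 𝔨

namespace Splitting

variable {𝔨 : Submodule ℝ 𝔤} {r s : ℕ} (D : Splitting 𝔨 r s)

/-- The dimension `d_i` of `𝔨_i`. -/
def d (i : Fin r ⊕ Fin s) : ℝ := Module.finrank ℝ (D.part i)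

/-- The constant `κ_i` with `B_i = -κ_i Q|_{𝔨_i}`, `B_i` the Killing form of `𝔨_i`. -/
def κ (i : Fin r ⊕ Fin s) : ℝ := kappa (D.part i)

/-- `g = α Q|_𝔞 + a_1 Q|_{𝔨_1} + ⋯ + a_{r+s} Q|_{𝔨_{r+s}}` with positive coefficients. -/
structure IsDiagonal (g : LeftInvMetric 𝔤) (α : ℝ) (a : Fin r ⊕ Fin s → ℝ) : Prop where
  pos : 0 < α
  pos' : ∀ i, 0 < a i
  on_compl : ∀ X ∈ orthCompl 𝔨, ∀ Y ∈ orthCompl 𝔨, g.form X Y = α * Q 𝔤 X Y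
  on_part : ∀ i, ∀ X ∈ D.part i, ∀ Y ∈ D.part i, g.form X Y = a i * Q 𝔤 X Y
  compl_part : ∀ i, ∀ X ∈ orthCompl 𝔨, ∀ Y ∈ D.part i, g.form X Y = 0
  part_part : ∀ i j, i ≠ j → ∀ X ∈ D.part i, ∀ Y ∈ D.part j, g.form X Y = 0

/-- The class of the metrics that are diagonal with respect to the decomposition `D`. -/
def metrics : Set (LeftInvMetric 𝔤) := {g | ∃ α a, D.IsDiagonal g α a}

/-- The metrics `g` that are diagonal with respect to `D` and satisfy `tr_g T = 1`. -/
def constrainedMetrics [FiniteDimensional ℝ 𝔤] (T : LeftInvMetric 𝔤) : Set (LeftInvMetric 𝔤) :=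
  {g | g ∈ D.metrics ∧ g.tr T.form = 1}

end Splitting

end Algebra

/-! ### Lie groups -/

section Group

variable {E : Type*} [NormedAddCommGroup E] [NormedSpace ℝ E]
  {G : Type*} [TopologicalSpace G] [ChartedSpace E G] [Group G]
  {F : Type*} [NormedAddCommGroup F] [NormedSpace ℝ F]
  {K : Type*} [TopologicalSpace K] [ChartedSpace F K] [Group K]

variable (E G) in
/-- The Lie algebra of a Lie group `G` modelled on the vector space `E`: the tangent space at the
identity with the bracket of left-invariant vector fields. -/
abbrev LieAlg : Type _ := GroupLieAlgebra 𝓘(ℝ, E) G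

instance instLieGroupMinSmoothness [LieGroup 𝓘(ℝ, E) ∞ G] :
    LieGroup 𝓘(ℝ, E) (minSmoothness ℝ 3) G :=
  LieGroup.of_le (n := ∞) (by
    rw [minSmoothness_of_isRCLikeNormedField]
    exact ENat.LEInfty.out)

instance instCompleteOfFiniteDimensional [FiniteDimensional ℝ E] : CompleteSpace E :=
  FiniteDimensional.complete ℝ E

instance instFiniteDimensionalLieAlg [FiniteDimensional ℝ E] :
    FiniteDimensional ℝ (LieAlg E G) :=
  inferInstanceAs (FiniteDimensional ℝ E)

/-- The differential at the identity of a map `f` with `f 1 = 1`. (The target of `mfderiv` is the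
tangent space at `f 1`, which is the tangent space at `1`.) -/
def diffOne (f : K → G) : LieAlg F K →ₗ[ℝ] LieAlg E G :=
  (mfderiv 𝓘(ℝ, F) 𝓘(ℝ, E) f 1 : F →L[ℝ] E).toLinearMap

/-- The adjoint representation: `Ad x` is the differential at the identity of
`y ↦ x y x⁻¹`. -/
def Ad (x : G) : LieAlg E G →ₗ[ℝ] LieAlg E G := diffOne fun y : G => x * y * x⁻¹

variable (E F) in
/-- The Lie algebra of the Lie subgroup `ι : K → G`, as a subspace of the Lie algebra of `G`. -/
def subAlg (ι : K →* G) : Submodule ℝ (LieAlg E G) :=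
  LinearMap.range (diffOne ι : LieAlg F K →ₗ[ℝ] LieAlg E G)

/-- `Ad(K)` acts irreducibly on the subspace `V` of the Lie algebra of `G` (in particular `V` is
invariant and nonzero). -/
def AdIrreducible (ι : K →* G) (V : Submodule ℝ (LieAlg E G)) : Prop :=
  V ≠ ⊥ ∧ (∀ k, ∀ X ∈ V, Ad (ι k) X ∈ V) ∧
    ∀ W ≤ V, (∀ k, ∀ X ∈ W, Ad (ι k) X ∈ W) → W = ⊥ ∨ W = V

end Group

end NaturallyReductive

end

/-! Let `n = dim 𝔞` and use the inverse coefficients `x = 1/α`, `y_i = 1/a_i`. The trace constraint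
becomes linear, `n T_𝔞 x + ∑ d_i T_i y_i = 1`, and the scalar curvature becomes homogeneous of
degree one: `4S = (n + 2 ∑ d_i(1-κ_i)) x + ∑ κ_i d_i y_i - ∑ d_i(1-κ_i) x²/y_i`
(`scalarCurvature_eq`). Existence: on the constraint simplex `4S ≤ μ + O(x)` with `μ = κ_m/T_m`
(`curvatureFun_le`). The inequality in the hypothesis says exactly that `4S` rises above `μ` to
first order on entering the simplex from the vertex `y_m = 1/(d_m T_m)` (`exists_curvatureFun_gt`).
A superlevel set above `μ` keeps `x` away from `0`. Since `κ_i < 1` (`κ_lt_one`), the terms `x²/y_i`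
then keep every `y_i` away from `0`, so that set lies in a compact one. Ricci curvature: at a
maximum, Euler's identity identifies the Lagrange multiplier with the maximal value `F > μ ≥ 0`
(`gradient_eq_of_isMax`). The `y_i`-derivative is `4d_i` times the coefficient of `Ric` on `𝔨_i`. On
`𝔞`, `Ric` is a combination of `Q` and the Casimir forms of the `𝔨_i`. If `Ad(K)` preserves each
`𝔨_i`, Schur's lemma makes these multiples of `Q` (`exists_casimirForm_eq`), and the `x`-derivative
is `4n` times the coefficient on `𝔞`. Mixed terms vanish, so `Ric = (F/4) T`. -/

noncomputable section

namespace NaturallyReductive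

/-! ### The adjoint action by Lie algebra automorphisms -/

section AdjointRepresentation

open VectorField

variable {E : Type*} [NormedAddCommGroup E] [NormedSpace ℝ E]
  {G : Type*} [TopologicalSpace G] [ChartedSpace E G] [Group G] [LieGroup 𝓘(ℝ, E) ∞ G]

/-- Conjugation by a fixed element of a Lie group is smooth. -/
theorem contMDiff_conj (x : G) : ContMDiff 𝓘(ℝ, E) 𝓘(ℝ, E) ∞ fun y : G => x * y * x⁻¹ :=
  (contMDiff_mul_right (a := x⁻¹)).comp (contMDiff_mul_left (a := x))

theorem mdifferentiableAt_conj (x y : G) :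
    MDifferentiableAt 𝓘(ℝ, E) 𝓘(ℝ, E) (fun y : G => x * y * x⁻¹) y :=
  ((contMDiff_conj x).contMDiffAt).mdifferentiableAt (by simp)

theorem mdifferentiableAt_mul_left (x y : G) :
    MDifferentiableAt 𝓘(ℝ, E) 𝓘(ℝ, E) (fun y : G => x * y) y :=
  ((contMDiff_mul_left (I := 𝓘(ℝ, E)) (n := ∞) (a := x)).contMDiffAt).mdifferentiableAt (by simp)

theorem mfderiv_conj_comp_conj (x y : G) :
    (mfderiv 𝓘(ℝ, E) 𝓘(ℝ, E) (fun z : G => x⁻¹ * z * x⁻¹⁻¹) (x * y * x⁻¹)).comp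
      (mfderiv 𝓘(ℝ, E) 𝓘(ℝ, E) (fun z : G => x * z * x⁻¹) y) =
      ContinuousLinearMap.id ℝ _ := by
  rw [← mfderiv_comp y (mdifferentiableAt_conj x⁻¹ _) (mdifferentiableAt_conj x y)]
  have : (fun z : G => x⁻¹ * z * x⁻¹⁻¹) ∘ (fun z : G => x * z * x⁻¹) = id := by
    ext z; simp [mul_assoc]
  rw [this]
  exact mfderiv_id

theorem mfderiv_conj_comp_conj' (x y : G) :
    (mfderiv 𝓘(ℝ, E) 𝓘(ℝ, E) (fun z : G => x * z * x⁻¹) y : E →L[ℝ] E).comp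
      (mfderiv 𝓘(ℝ, E) 𝓘(ℝ, E) (fun z : G => x⁻¹ * z * x⁻¹⁻¹) (x * y * x⁻¹) : E →L[ℝ] E) =
      ContinuousLinearMap.id ℝ E := by
  have h := mfderiv_conj_comp_conj (E := E) x⁻¹ (x * y * x⁻¹)
  have h1 : x⁻¹ * (x * y * x⁻¹) * x⁻¹⁻¹ = y := by group
  rw [h1] at h
  rw [inv_inv] at h ⊢
  exact h

theorem inverse_mfderiv_conj (x y : G) :
    (mfderiv 𝓘(ℝ, E) 𝓘(ℝ, E) (fun z : G => x * z * x⁻¹) y).inverse =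
      mfderiv 𝓘(ℝ, E) 𝓘(ℝ, E) (fun z : G => x⁻¹ * z * x⁻¹⁻¹) (x * y * x⁻¹) :=
  ContinuousLinearMap.inverse_eq (mfderiv_conj_comp_conj' x y) (mfderiv_conj_comp_conj x y)

theorem Ad_inv_Ad (x : G) (v : LieAlg E G) : Ad x⁻¹ (Ad x v) = v := by
  have h := mfderiv_conj_comp_conj (E := E) x 1
  have h1 : x * 1 * x⁻¹ = 1 := by group
  rw [h1] at h
  exact congrArg (fun L : E →L[ℝ] E => L v) h

/-- Conjugation by `x⁻¹` intertwines left translation by `x h x⁻¹` with left translation by `h`;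
differentiate this at `1`. -/
theorem mpullback_conj_mulInvariantVectorField (x : G) (v : LieAlg E G) :
    mpullback 𝓘(ℝ, E) 𝓘(ℝ, E) (fun z : G => x * z * x⁻¹) (mulInvariantVectorField v) =
      mulInvariantVectorField (Ad x⁻¹ v : LieAlg E G) := by
  ext h
  simp only [mpullback, inverse_mfderiv_conj, mulInvariantVectorField]
  have e : (fun z : G => x⁻¹ * z * x⁻¹⁻¹) ∘ (fun y => (x * h * x⁻¹) * y) =
      (fun y => h * y) ∘ (fun z : G => x⁻¹ * z * x⁻¹⁻¹) := by
    ext y; simp only [Function.comp_apply]; group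
  have e1 := mfderiv_comp (1 : G) (I := 𝓘(ℝ, E)) (I' := 𝓘(ℝ, E)) (I'' := 𝓘(ℝ, E))
    (mdifferentiableAt_conj (E := E) x⁻¹ (x * h * x⁻¹ * 1))
    (mdifferentiableAt_mul_left (E := E) (x * h * x⁻¹) 1)
  have e2 := mfderiv_comp (1 : G) (I := 𝓘(ℝ, E)) (I' := 𝓘(ℝ, E)) (I'' := 𝓘(ℝ, E))
    (mdifferentiableAt_mul_left (E := E) h (x⁻¹ * 1 * x⁻¹⁻¹))
    (mdifferentiableAt_conj (E := E) x⁻¹ 1)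
  rw [e] at e1
  have e3 := e1.symm.trans e2
  have h1 : x⁻¹ * 1 * x⁻¹⁻¹ = 1 := by group
  have h2 : x * h * x⁻¹ * 1 = x * h * x⁻¹ := by group
  rw [h1, h2] at e3
  exact congrArg (fun L : E →L[ℝ] E => L v) e3

/-- The adjoint action is by Lie algebra homomorphisms. -/
theorem Ad_lie [FiniteDimensional ℝ E] (x : G) (v w : LieAlg E G) :
    Ad x ⁅v, w⁆ = ⁅Ad x v, Ad x w⁆ := by
  -- Pulling back along conjugation by `x` realises `Ad x⁻¹` on invariant fields and commutes with
  -- their bracket; hence the inverse.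
  have key : ∀ (x : G) (v w : LieAlg E G), Ad x⁻¹ ⁅v, w⁆ = ⁅Ad x⁻¹ v, Ad x⁻¹ w⁆ := by
    intro x v w
    have h := mpullback_mlieBracket (I := 𝓘(ℝ, E)) (I' := 𝓘(ℝ, E)) (x₀ := (1 : G)) (n := ∞)
      (f := fun z : G => x * z * x⁻¹)
      (mdifferentiableAt_mulInvariantVectorField v)
      (mdifferentiableAt_mulInvariantVectorField w) (contMDiff_conj x).contMDiffAt
      (by rw [minSmoothness_of_isRCLikeNormedField]; exact ENat.LEInfty.out)
    rw [mpullback_conj_mulInvariantVectorField, mpullback_conj_mulInvariantVectorField,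
      mpullback_apply, inverse_mfderiv_conj] at h
    have h1 : x * 1 * x⁻¹ = 1 := by group
    rw [h1] at h
    exact h
  simpa using key x⁻¹ v w

/-- The adjoint action as a Lie algebra automorphism. -/
def AdEquiv [FiniteDimensional ℝ E] (x : G) : LieAlg E G ≃ₗ⁅ℝ⁆ LieAlg E G :=
  { toLinearMap := Ad x
    map_lie' := Ad_lie x _ _
    invFun := Ad x⁻¹
    left_inv := Ad_inv_Ad x
    right_inv := fun v => by simpa using Ad_inv_Ad x⁻¹ v }

end AdjointRepresentation

/-! ### Traces in bases that diagonalise a bilinear form -/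

section DiagonalBasis

variable {n : Type*} [Fintype n] [DecidableEq n] {M : Type*} [AddCommGroup M] [Module ℝ M]

theorem bilin_basis_right {B : LinearMap.BilinForm ℝ M} {b : Module.Basis n ℝ M} {p : n → ℝ}
    (hb : ∀ s t, B (b s) (b t) = if s = t then p s else 0) (X : M) (s : n) :
    B X (b s) = p s * b.repr X s := by
  conv_lhs => rw [← b.sum_repr X]
  simp only [map_sum, map_smul, LinearMap.sum_apply, LinearMap.smul_apply, smul_eq_mul, hb,
    mul_ite, mul_zero, Finset.sum_ite_eq', Finset.mem_univ, if_true]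
  exact mul_comm _ _

theorem trace_eq_sum_div {B : LinearMap.BilinForm ℝ M} {b : Module.Basis n ℝ M} {p : n → ℝ}
    (hb : ∀ s t, B (b s) (b t) = if s = t then p s else 0) (hp : ∀ s, p s ≠ 0)
    (f : M →ₗ[ℝ] M) : LinearMap.trace ℝ M f = ∑ s, B (f (b s)) (b s) / p s := by
  rw [LinearMap.trace_eq_matrix_trace ℝ b, Matrix.trace]
  refine Finset.sum_congr rfl fun s _ => ?_
  rw [bilin_basis_right hb, Matrix.diag_apply, LinearMap.toMatrix_apply,
    mul_div_cancel_left₀ _ (hp s)]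

theorem trace_eq_sum {B : LinearMap.BilinForm ℝ M} {b : Module.Basis n ℝ M}
    (hb : ∀ s t, B (b s) (b t) = if s = t then 1 else 0) (f : M →ₗ[ℝ] M) :
    LinearMap.trace ℝ M f = ∑ s, B (f (b s)) (b s) := by
  simpa using trace_eq_sum_div (p := fun _ => 1) hb (fun _ => one_ne_zero) f

theorem linear_eq_sum {B : LinearMap.BilinForm ℝ M} {b : Module.Basis n ℝ M}
    (hb : ∀ s t, B (b s) (b t) = if s = t then 1 else 0) (f : M →ₗ[ℝ] ℝ) (X : M) :
    f X = ∑ s, f (b s) * B X (b s) := by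
  conv_lhs => rw [← b.sum_repr X]
  simp only [map_sum, map_smul, smul_eq_mul]
  refine Finset.sum_congr rfl fun s _ => ?_
  rw [bilin_basis_right (p := fun _ => 1) hb, one_mul, mul_comm]

/-- The trace of a bilinear form does not depend on the orthonormal basis. -/
theorem sum_bilin_eq_sum_bilin {B : LinearMap.BilinForm ℝ M} (hB : ∀ X Y, B X Y = B Y X)
    {b b' : Module.Basis n ℝ M} (hb : ∀ s t, B (b s) (b t) = if s = t then 1 else 0)
    (hb' : ∀ s t, B (b' s) (b' t) = if s = t then 1 else 0) (H : LinearMap.BilinForm ℝ M) :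
    ∑ s, H (b s) (b s) = ∑ s, H (b' s) (b' s) := by
  simp_rw [fun s => linear_eq_sum hb' (H (b s)) (b s)]
  rw [Finset.sum_comm]
  refine Finset.sum_congr rfl fun t _ => ?_
  rw [linear_eq_sum hb (H.flip (b' t)) (b' t) |> (LinearMap.flip_apply H _ _).symm.trans]
  exact Finset.sum_congr rfl fun s _ => by rw [hB (b s)]; rfl

end DiagonalBasis

/-! ### Ricci curvature in a `Q`-orthonormal eigenbasis of the metric -/

section Algebra

variable {𝔤 : Type*} [LieRing 𝔤] [LieAlgebra ℝ 𝔤]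

theorem Q_comm (X Y : 𝔤) : Q 𝔤 X Y = Q 𝔤 Y X := by
  simp only [Q, LinearMap.neg_apply]
  rw [LieModule.traceForm_comm]

theorem Q_lie (X Y Z : 𝔤) : Q 𝔤 ⁅X, Y⁆ Z = Q 𝔤 X ⁅Y, Z⁆ := by
  simp only [Q, LinearMap.neg_apply, killingForm]
  rw [LieModule.traceForm_apply_lie_apply]

theorem Q_lie_left (X Y Z : 𝔤) : Q 𝔤 ⁅X, Y⁆ Z = -Q 𝔤 Y ⁅X, Z⁆ := by
  rw [← lie_skew, map_neg, LinearMap.neg_apply, Q_lie]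

theorem Q_equiv (e : 𝔤 ≃ₗ⁅ℝ⁆ 𝔤) (X Y : 𝔤) : Q 𝔤 (e X) (e Y) = Q 𝔤 X Y := by
  simp [Q, LieAlgebra.killingForm_of_equiv_apply]

variable {n : Type*} [Fintype n] [DecidableEq n]

/-- `ad X` is `Q`-skew, so its diagonal entries vanish: this is unimodularity. -/
theorem trace_ad_eq_zero {b : Module.Basis n ℝ 𝔤}
    (hb : ∀ s t, Q 𝔤 (b s) (b t) = if s = t then 1 else 0) (X : 𝔤) :
    LinearMap.trace ℝ 𝔤 (LieAlgebra.ad ℝ 𝔤 X) = 0 := by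
  rw [trace_eq_sum hb]
  refine Finset.sum_eq_zero fun s _ => ?_
  have h := Q_lie_left X (b s) (b s)
  rw [Q_comm (b s)] at h
  rw [LieAlgebra.ad_apply]
  linarith

variable [FiniteDimensional ℝ 𝔤]

theorem traceWrt_eq_sum_div {B : LinearMap.BilinForm ℝ 𝔤} (hB : B.Nondegenerate)
    {b : Module.Basis n ℝ 𝔤} {p : n → ℝ}
    (hb : ∀ s t, B (b s) (b t) = if s = t then p s else 0) (hp : ∀ s, p s ≠ 0)
    (T : LinearMap.BilinForm ℝ 𝔤) : traceWrt B hB T = ∑ s, T (b s) (b s) / p s := by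
  rw [traceWrt, trace_eq_sum_div hb hp]
  refine Finset.sum_congr rfl fun s _ => ?_
  congr 1
  exact LinearMap.congr_fun ((B.toDual hB).apply_symm_apply (T (b s))) (b s)

namespace LeftInvMetric

variable (g : LeftInvMetric 𝔤)

/-- The Ricci curvature of a unimodular Lie algebra is `-tr (L_Y L_Z)`, where `L_Z X = ∇_X Z`. -/
theorem ricci_eq_neg_trace {b : Module.Basis n ℝ 𝔤} {p : n → ℝ}
    (hb : ∀ s t, g.form (b s) (b t) = if s = t then p s else 0) (hp : ∀ s, p s ≠ 0)
    (hu : ∀ X : 𝔤, LinearMap.trace ℝ 𝔤 (LieAlgebra.ad ℝ 𝔤 X) = 0) (Y Z : 𝔤) :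
    g.ricci Y Z = -LinearMap.trace ℝ 𝔤 (g.nabla.flip Y ∘ₗ g.nabla.flip Z) := by
  have h1 : ∀ W, g.nabla.flip W = g.nabla W - LieAlgebra.ad ℝ 𝔤 W := by
    intro W
    ext X
    rw [LinearMap.flip_apply, LinearMap.sub_apply, LieAlgebra.ad_apply, ← g.nabla_torsion W X]
    abel
  -- Metric compatibility makes `∇_W` skew for `g`.
  have h2 : ∀ W, LinearMap.trace ℝ 𝔤 (g.nabla W) = 0 := by
    intro W
    rw [trace_eq_sum_div hb hp]
    refine Finset.sum_eq_zero fun s _ => ?_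
    have := g.nabla_metric W (b s) (b s)
    rw [g.symm (b s)] at this
    rw [div_eq_zero_iff]; left; linarith
  -- With `L_W = ∇_W - ad W`, the first term is traceless by `h2` and unimodularity. The other two
  -- combine under the trace to `-(∇_Y - ad Y) L_Z = -L_Y L_Z`.
  have h3 : g.curvatureLeft Y Z = g.nabla.flip (g.nabla Y Z) - g.nabla Y ∘ₗ g.nabla.flip Z
      + g.nabla.flip Z ∘ₗ LieAlgebra.ad ℝ 𝔤 Y := by
    ext X
    simp only [curvatureLeft, curvature, LinearMap.coe_mk, AddHom.coe_mk, LinearMap.sub_apply,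
      LinearMap.comp_apply, LinearMap.flip_apply, LinearMap.add_apply, LieAlgebra.ad_apply]
    rw [← lie_skew Y X, map_neg, LinearMap.neg_apply]
    abel
  change LinearMap.trace ℝ 𝔤 (g.curvatureLeft Y Z) = _
  rw [h3, h1 (g.nabla Y Z), h1 Y, LinearMap.sub_comp]
  simp only [map_add, map_sub, h2, hu]
  rw [LinearMap.trace_comp_comm' (LieAlgebra.ad ℝ 𝔤 Y)]
  ring

/-- The Ricci curvature of a metric that is diagonal in a `Q`-orthonormal basis, on a pair of
eigenvectors of the metric. -/
theorem ricci_eq_sum {b : Module.Basis n ℝ 𝔤} {p : n → ℝ}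
    (hb : ∀ s t, Q 𝔤 (b s) (b t) = if s = t then 1 else 0) (hp : ∀ s, p s ≠ 0)
    (hg : ∀ X s, g.form X (b s) = p s * Q 𝔤 X (b s)) {Y Z : 𝔤} {β γ : ℝ}
    (hY : ∀ X, g.form X Y = β * Q 𝔤 X Y) (hZ : ∀ X, g.form X Z = γ * Q 𝔤 X Z) :
    g.ricci Y Z = 1 / 4 * ∑ s, ∑ t, Q 𝔤 ⁅Y, b s⁆ (b t) * Q 𝔤 ⁅Z, b s⁆ (b t) *
      ((p t - p s + γ) * (p s - p t + β) / (p s * p t)) := by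
  have hgb : ∀ s t, g.form (b s) (b t) = if s = t then p s else 0 := by
    intro s t
    rw [hg, hb]
    split_ifs with h
    · rw [h, mul_one]
    · rw [mul_zero]
  have hskew : ∀ X s t, Q 𝔤 ⁅X, b t⁆ (b s) = -Q 𝔤 ⁅X, b s⁆ (b t) := fun X s t => by
    rw [Q_lie_left, Q_comm]
  -- By invariance of `Q`, each term of the Koszul formula is a weight times the same number `Q([W,
  -- b_s], b_t)`, up to sign.
  have hL : ∀ (W : 𝔤) (w : ℝ), (∀ X, g.form X W = w * Q 𝔤 X W) → ∀ s t,
      Q 𝔤 (g.nabla (b s) W) (b t) = -(p t - p s + w) / (2 * p t) * Q 𝔤 ⁅W, b s⁆ (b t) := by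
    intro W w hW s t
    have h1 := g.form_nabla (b s) W (b t)
    rw [hg, hg, hg, hW, hskew, ← lie_skew, map_neg, LinearMap.neg_apply, Q_lie (b t),
      ← lie_skew (b s) W, map_neg, Q_comm (b t)] at h1
    have := hp t
    field_simp
    linarith
  rw [g.ricci_eq_neg_trace hgb hp, trace_eq_sum hb]
  · simp only [LinearMap.comp_apply, LinearMap.flip_apply]
    rw [Finset.mul_sum, ← Finset.sum_neg_distrib]
    refine Finset.sum_congr rfl fun s _ => ?_
    have h2 : Q 𝔤 (g.nabla (g.nabla (b s) Z) Y) (b s) =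
        ∑ t, Q 𝔤 (g.nabla (b t) Y) (b s) * Q 𝔤 (g.nabla (b s) Z) (b t) :=
      linear_eq_sum hb ((Q 𝔤).flip (b s) ∘ₗ g.nabla.flip Y) _
    rw [h2, Finset.mul_sum, ← Finset.sum_neg_distrib]
    refine Finset.sum_congr rfl fun t _ => ?_
    rw [hL Y β hY, hL Z γ hZ, hskew]
    have := hp t
    have := hp s
    field_simp
    ring
  · exact trace_ad_eq_zero hb

end LeftInvMetric
end Algebra

theorem exists_orthonormal_basis {M : Type*} [AddCommGroup M] [Module ℝ M] [FiniteDimensional ℝ M]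
    {B : LinearMap.BilinForm ℝ M} (hB : ∀ X Y, B X Y = B Y X) (hpos : ∀ X, X ≠ 0 → 0 < B X X) :
    ∃ b : Module.Basis (Fin (Module.finrank ℝ M)) ℝ M,
      ∀ s t, B (b s) (b t) = if s = t then 1 else 0 := by
  obtain ⟨v, hv⟩ := LinearMap.BilinForm.exists_orthogonal_basis (B := B) ⟨hB⟩
  have hv0 : ∀ s, 0 < B (v s) (v s) := fun s => hpos _ (v.ne_zero s)
  have hu : ∀ s, IsUnit (Real.sqrt (B (v s) (v s)))⁻¹ := fun s =>
    (inv_ne_zero (Real.sqrt_pos.2 (hv0 s)).ne').isUnit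
  refine ⟨v.isUnitSMul hu, fun s t => ?_⟩
  simp only [Module.Basis.isUnitSMul_apply, map_smul, LinearMap.smul_apply, smul_eq_mul]
  split_ifs with h
  · subst h
    have h1 := Real.mul_self_sqrt (hv0 s).le
    have h2 := (Real.sqrt_pos.2 (hv0 s)).ne'
    field_simp
    rw [sq, h1]
  · rw [(LinearMap.isOrthoᵢ_def.1 hv) s t h]
    simp

/-! ### Orthonormal bases adapted to `𝔤 = 𝔞 ⊕ 𝔨_1 ⊕ ⋯ ⊕ 𝔨_{r+s}` -/

namespace Splitting

variable {𝔤 : Type*} [LieRing 𝔤] [LieAlgebra ℝ 𝔤] {𝔨 : Submodule ℝ 𝔤} {r s : ℕ}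

/-- The summands of the decomposition `𝔤 = 𝔞 ⊕ 𝔨_1 ⊕ ⋯ ⊕ 𝔨_{r+s}`, where `none` stands for `𝔞`. -/
def component (D : Splitting 𝔨 r s) : Option (Fin r ⊕ Fin s) → Submodule ℝ 𝔤
  | none => orthCompl 𝔨
  | some i => (D.part i).toSubmodule

variable (D : Splitting 𝔨 r s)

theorem part_le (i : Fin r ⊕ Fin s) : (D.part i).toSubmodule ≤ 𝔨 := by
  conv_rhs => rw [← D.iSup_eq]
  exact le_iSup (fun i => (D.part i).toSubmodule) i

theorem component_orthogonal {j k : Option (Fin r ⊕ Fin s)} (h : j ≠ k) {X Y : 𝔤}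
    (hX : X ∈ D.component j) (hY : Y ∈ D.component k) : Q 𝔤 X Y = 0 := by
  rcases j with _ | i <;> rcases k with _ | k
  · exact absurd rfl h
  · rw [Q_comm]
    exact LinearMap.BilinForm.mem_orthogonal_iff.1 hX Y (D.part_le k hY)
  · exact LinearMap.BilinForm.mem_orthogonal_iff.1 hY X (D.part_le i hX)
  · exact D.orthogonal i k (fun h' => h (congrArg some h')) X hX Y hY

variable {D} in
-- Positivity of `Q` is read off from `T`, which is positive definite and a positive multiple of `Q`
-- on each summand.
theorem IsDiagonal.Q_pos_of_mem {T : LeftInvMetric 𝔤} {α : ℝ} {a : Fin r ⊕ Fin s → ℝ}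
    (hT : D.IsDiagonal T α a) {j : Option (Fin r ⊕ Fin s)} {X : 𝔤} (hX : X ∈ D.component j)
    (h0 : X ≠ 0) : 0 < Q 𝔤 X X := by
  have h := T.pos X h0
  rcases j with _ | i
  · rw [hT.on_compl X hX X hX] at h
    exact (mul_pos_iff_of_pos_left hT.pos).1 h
  · rw [hT.on_part i X hX X hX] at h
    exact (mul_pos_iff_of_pos_left (hT.pos' i)).1 h

variable [FiniteDimensional ℝ 𝔤]

/-- The index type of the bases of `𝔤` adapted to the decomposition `D`. -/
abbrev Index : Type := Σ j : Option (Fin r ⊕ Fin s), Fin (Module.finrank ℝ (D.component j))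

/-- A `Q`-orthonormal basis of `𝔤` adapted to the decomposition `D`. -/
structure AdaptedBasis where
  part : ∀ j, Module.Basis (Fin (Module.finrank ℝ (D.component j))) ℝ (D.component j)
  basis : Module.Basis D.Index ℝ 𝔤
  basis_apply : ∀ j u, basis ⟨j, u⟩ = part j u
  orthonormal : ∀ s t, Q 𝔤 (basis s) (basis t) = if s = t then 1 else 0

variable {D} in
theorem IsDiagonal.nonempty_adaptedBasis {T : LeftInvMetric 𝔤} {α : ℝ} {a : Fin r ⊕ Fin s → ℝ}
    (hT : D.IsDiagonal T α a) : Nonempty D.AdaptedBasis := by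
  have h1 : ∀ j, ∃ b : Module.Basis (Fin (Module.finrank ℝ (D.component j))) ℝ (D.component j),
      ∀ u v, Q 𝔤 (b u) (b v) = if u = v then 1 else 0 := fun j =>
    exists_orthonormal_basis (B := (Q 𝔤).restrict (D.component j)) (fun X Y => Q_comm _ _)
      fun X hX => hT.Q_pos_of_mem X.2 (by simpa using hX)
  choose b hb using h1
  set e : D.Index → 𝔤 := fun s => b s.1 s.2 with he
  have hmem : ∀ s, e s ∈ D.component s.1 := fun s => (b s.1 s.2).2
  have horth : ∀ s t, Q 𝔤 (e s) (e t) = if s = t then 1 else 0 := by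
    rintro ⟨j, u⟩ ⟨k, v⟩
    by_cases hjk : j = k
    · subst hjk
      rw [he, hb]
      simp
    · rw [D.component_orthogonal hjk (hmem ⟨j, u⟩) (hmem ⟨k, v⟩), if_neg]
      simp [hjk]
  have hspan_comp : ∀ j, D.component j ≤ Submodule.span ℝ (Set.range e) := by
    intro j X hX
    have h2 : _ = X := congrArg Subtype.val ((b j).sum_repr ⟨X, hX⟩)
    rw [← h2, Submodule.coe_sum]
    exact Submodule.sum_mem _ fun u _ =>
      Submodule.smul_mem _ _ (Submodule.subset_span ⟨⟨j, u⟩, rfl⟩)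
  have hli : LinearIndependent ℝ e := by
    refine LinearMap.linearIndependent_of_isOrthoᵢ (B := Q 𝔤) ?_ fun s => ?_
    · rw [LinearMap.isOrthoᵢ_def]
      intro s t hst
      rw [horth, if_neg hst]
    · rw [horth]
      simp
  -- Subtract from `X` its projection `P` to the span. The remainder is orthogonal to `𝔨`, hence
  -- lies in `𝔞`, which is itself inside the span.
  have hspan : ⊤ ≤ Submodule.span ℝ (Set.range e) := by
    intro X _
    set P : 𝔤 := ∑ s, Q 𝔤 X (e s) • e s with hP
    have hPX : ∀ s, Q 𝔤 (e s) (X - P) = 0 := by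
      intro s
      rw [hP, map_sub, map_sum]
      simp [horth, Q_comm X]
    have hX : X - P ∈ D.component none := by
      refine LinearMap.BilinForm.mem_orthogonal_iff.2 fun Y hY => ?_
      have hk : 𝔨 ≤ LinearMap.ker ((Q 𝔤).flip (X - P)) := by
        conv_lhs => rw [← D.iSup_eq]
        refine iSup_le fun i Z hZ => ?_
        have h3 : Submodule.span ℝ (Set.range e) ≤ LinearMap.ker ((Q 𝔤).flip (X - P)) := by
          rw [Submodule.span_le]
          rintro _ ⟨s, rfl⟩
          exact hPX s
        exact h3 (hspan_comp (some i) hZ)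
      exact hk hY
    have : X = (X - P) + P := by abel
    rw [this]
    refine Submodule.add_mem _ (hspan_comp none hX) (Submodule.sum_mem _ fun s _ =>
      Submodule.smul_mem _ _ (Submodule.subset_span ⟨s, rfl⟩))
  exact ⟨⟨b, Module.Basis.mk hli hspan, fun j u => by rw [Module.Basis.mk_apply], fun s t => by
    rw [Module.Basis.mk_apply, Module.Basis.mk_apply, horth]⟩⟩

end Splitting

/-! ### Block structure of `ad` and Ricci curvature of diagonal metrics -/

namespace Splitting

variable {𝔤 : Type*} [LieRing 𝔤] [LieAlgebra ℝ 𝔤]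
  {𝔨 : Submodule ℝ 𝔤} {r s : ℕ} {D : Splitting 𝔨 r s}

/-- The coefficients of a diagonal metric as a function on the set of summands of `𝔤`. -/
def weight (α : ℝ) (a : Fin r ⊕ Fin s → ℝ) : Option (Fin r ⊕ Fin s) → ℝ
  | none => α
  | some i => a i

namespace AdaptedBasis

variable (A : D.AdaptedBasis)

theorem basis_mem (t : D.Index) : A.basis t ∈ D.component t.1 := by
  rw [A.basis_apply]
  exact (A.part t.1 t.2).2

include A in
theorem Q_pos {X : 𝔤} (hX : X ≠ 0) : 0 < Q 𝔤 X X := by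
  have h := linear_eq_sum A.orthonormal (Q 𝔤 X) X
  have h0 : 0 ≤ Q 𝔤 X X := by
    rw [h]
    exact Finset.sum_nonneg fun t _ => mul_self_nonneg _
  refine h0.lt_of_ne fun h1 => hX (A.basis.repr.map_eq_zero_iff.1 ?_)
  rw [← h1, eq_comm, Finset.sum_eq_zero_iff_of_nonneg fun t _ => mul_self_nonneg _] at h
  ext t
  have h2 := mul_self_eq_zero.1 (h t (Finset.mem_univ t))
  rw [bilin_basis_right (p := fun _ => 1) A.orthonormal, one_mul] at h2
  exact h2

include A in
-- The bracket of two simple ideals lies in both; they are orthogonal, so it is `Q`-null, and `Q` is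
-- positive. If one summand is a line, centrality suffices.
theorem lie_eq_zero {i j : Fin r ⊕ Fin s} (h : i ≠ j) {X Y : 𝔤} (hX : X ∈ D.part i)
    (hY : Y ∈ D.part j) : ⁅X, Y⁆ = 0 := by
  rcases j with j | j
  · rcases i with i | i
    · by_contra h0
      have h1 : ⁅X, Y⁆ ∈ D.part (Sum.inl j) := D.ideal j X (D.part_le _ hX) Y hY
      have h2 : ⁅X, Y⁆ ∈ D.part (Sum.inl i) := by
        rw [← lie_skew]
        exact neg_mem (D.ideal i Y (D.part_le _ hY) X hX)
      exact (A.Q_pos h0).ne' (D.orthogonal _ _ h _ h2 _ h1)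
    · rw [← lie_skew, D.central i Y (D.part_le _ hY) X hX, neg_zero]
  · exact D.central j X (D.part_le _ hX) Y hY

include A in
theorem lie_mem {i j : Fin r ⊕ Fin s} {X Y : 𝔤} (hX : X ∈ D.part i) (hY : Y ∈ D.part j) :
    ⁅X, Y⁆ ∈ D.part j := by
  by_cases h : i = j
  · subst h
    exact (D.part i).lie_mem hX hY
  · rw [A.lie_eq_zero h hX hY]
    exact zero_mem _

include A in
-- `ad X` preserves every `𝔨_j` and is skew, so it also preserves `𝔞`: its matrix is block diagonal.
theorem Q_lie_part_eq_zero {i : Fin r ⊕ Fin s} {U V : Option (Fin r ⊕ Fin s)} (h : U ≠ V)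
    {X Y Z : 𝔤} (hX : X ∈ D.part i) (hY : Y ∈ D.component U) (hZ : Z ∈ D.component V) :
    Q 𝔤 ⁅X, Y⁆ Z = 0 := by
  rcases U with _ | j
  · rcases V with _ | k
    · exact absurd rfl h
    · rw [Q_lie_left, D.component_orthogonal h hY (A.lie_mem hX hZ), neg_zero]
  · exact D.component_orthogonal h (A.lie_mem hX hY) hZ

include A in
theorem Q_lie_compl_eq_zero {i j : Fin r ⊕ Fin s} {X Y Z : 𝔤} (hX : X ∈ orthCompl 𝔨)
    (hY : Y ∈ D.part i) (hZ : Z ∈ D.part j) : Q 𝔤 ⁅X, Y⁆ Z = 0 := by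
  rw [Q_lie]
  exact D.component_orthogonal (j := none) (k := some j) (by simp) hX (A.lie_mem hY hZ)

/-- The sum of the products of the matrix entries of `ad Y` and `ad Z` over the block `(U, V)`. -/
def blockSum (U V : Option (Fin r ⊕ Fin s)) (Y Z : 𝔤) : ℝ :=
  ∑ u, ∑ v, Q 𝔤 ⁅Y, A.basis ⟨U, u⟩⁆ (A.basis ⟨V, v⟩) * Q 𝔤 ⁅Z, A.basis ⟨U, u⟩⁆ (A.basis ⟨V, v⟩)

theorem blockSum_symm (U V : Option (Fin r ⊕ Fin s)) (Y Z : 𝔤) :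
    A.blockSum U V Y Z = A.blockSum V U Y Z := by
  rw [blockSum, Finset.sum_comm]
  refine Finset.sum_congr rfl fun u _ => Finset.sum_congr rfl fun v _ => ?_
  rw [Q_lie_left Y, Q_lie_left Z, Q_comm, Q_comm (A.basis ⟨U, v⟩)]
  ring

/-- As `ad` is skew, minus the Killing form is the Hilbert–Schmidt product of `ad Y` and `ad Z`. -/
theorem sum_sum_blockSum (Y Z : 𝔤) : ∑ U, ∑ V, A.blockSum U V Y Z = Q 𝔤 Y Z := by
  have h : Q 𝔤 Y Z = ∑ x : D.Index, ∑ y : D.Index, Q 𝔤 ⁅Y, A.basis x⁆ (A.basis y) *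
      Q 𝔤 ⁅Z, A.basis x⁆ (A.basis y) := by
    have h1 : Q 𝔤 Y Z = -killingForm ℝ 𝔤 Y Z := rfl
    rw [h1, killingForm_apply_apply, trace_eq_sum A.orthonormal, ← Finset.sum_neg_distrib]
    refine Finset.sum_congr rfl fun x _ => ?_
    rw [LinearMap.comp_apply, LieAlgebra.ad_apply, LieAlgebra.ad_apply, Q_lie_left, neg_neg, Q_comm,
      linear_eq_sum A.orthonormal (Q 𝔤 ⁅Y, A.basis x⁆)]
  rw [h, Fintype.sum_sigma]
  refine Finset.sum_congr rfl fun U _ => ?_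
  simp only [blockSum, Fintype.sum_sigma]
  rw [Finset.sum_comm]

theorem blockSum_eq_zero {U V : Option (Fin r ⊕ Fin s)} {Y Z : 𝔤}
    (h : ∀ S ∈ D.component U, ∀ T ∈ D.component V, Q 𝔤 ⁅Y, S⁆ T = 0) :
    A.blockSum U V Y Z = 0 :=
  Finset.sum_eq_zero fun u _ => Finset.sum_eq_zero fun v _ => by
    rw [h _ (A.basis_mem ⟨U, u⟩) _ (A.basis_mem ⟨V, v⟩), zero_mul]

theorem blockSum_comm (U V : Option (Fin r ⊕ Fin s)) (Y Z : 𝔤) :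
    A.blockSum U V Y Z = A.blockSum U V Z Y :=
  Finset.sum_congr rfl fun _ _ => Finset.sum_congr rfl fun _ _ => mul_comm _ _

theorem blockSum_of_mem_part {i : Fin r ⊕ Fin s} {U V : Option (Fin r ⊕ Fin s)} {Y : 𝔤}
    (hY : Y ∈ D.part i) (Z : 𝔤) (h : U ≠ V) : A.blockSum U V Y Z = 0 :=
  A.blockSum_eq_zero fun _ hS _ hT => A.Q_lie_part_eq_zero h hY hS hT

theorem blockSum_of_mem_part' {i j : Fin r ⊕ Fin s} {Y : 𝔤} (hY : Y ∈ D.part i) (Z : 𝔤)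
    (h : i ≠ j) (V : Option (Fin r ⊕ Fin s)) : A.blockSum (some j) V Y Z = 0 :=
  A.blockSum_eq_zero fun S hS _ _ => by rw [A.lie_eq_zero h hY hS, map_zero, LinearMap.zero_apply]

theorem blockSum_of_mem_compl {Y : 𝔤} (hY : Y ∈ orthCompl 𝔨) (Z : 𝔤) (i j : Fin r ⊕ Fin s) :
    A.blockSum (some i) (some j) Y Z = 0 :=
  A.blockSum_eq_zero fun _ hS _ hT => A.Q_lie_compl_eq_zero hY hS hT

include A in
theorem form_eq {g : LeftInvMetric 𝔤} {α : ℝ} {a : Fin r ⊕ Fin s → ℝ} (hg : D.IsDiagonal g α a)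
    {j : Option (Fin r ⊕ Fin s)} {Y : 𝔤} (hY : Y ∈ D.component j) (X : 𝔤) :
    g.form X Y = weight α a j * Q 𝔤 X Y := by
  suffices h : g.form.flip Y = weight α a j • (Q 𝔤).flip Y from LinearMap.congr_fun h X
  refine A.basis.ext fun x => ?_
  have hx := A.basis_mem x
  generalize A.basis x = Z at hx
  change g.form Z Y = weight α a j * Q 𝔤 Z Y
  by_cases h : x.1 = j
  · rw [h] at hx
    rcases j with _ | j
    · exact hg.on_compl Z hx Y hY
    · exact hg.on_part j Z hx Y hY
  · rw [D.component_orthogonal h hx hY, mul_zero]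
    generalize x.1 = k at h hx
    rcases j with _ | j <;> rcases k with _ | k
    · exact absurd rfl h
    · rw [g.symm]
      exact hg.compl_part k Y hY Z hx
    · exact hg.compl_part j Z hx Y hY
    · exact hg.part_part k j (fun h' => h (congrArg some h')) Z hx Y hY

theorem weight_pos {g : LeftInvMetric 𝔤} {α : ℝ} {a : Fin r ⊕ Fin s → ℝ}
    (hg : D.IsDiagonal g α a) (j : Option (Fin r ⊕ Fin s)) : 0 < weight α a j := by
  rcases j with _ | j
  · exact hg.pos
  · exact hg.pos' j

/-- Only the blocks `(𝔞, 𝔞)` and `(𝔨_i, 𝔨_i)` of `ad Y` can be nonzero. -/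
theorem blockSum_none_of_mem_part {i : Fin r ⊕ Fin s} {Y Z : 𝔤} (hY : Y ∈ D.part i) :
    A.blockSum none none Y Z = Q 𝔤 Y Z - A.blockSum (some i) (some i) Y Z := by
  rw [← A.sum_sum_blockSum, Fintype.sum_option,
    Finset.sum_eq_single_of_mem none (Finset.mem_univ _)
      fun V _ h => A.blockSum_of_mem_part hY Z h.symm,
    Finset.sum_eq_single_of_mem i (Finset.mem_univ _)
      fun j _ h => Finset.sum_eq_zero fun V _ => A.blockSum_of_mem_part' hY Z h.symm V,
    Finset.sum_eq_single_of_mem (some i) (Finset.mem_univ _)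
      fun V _ h => A.blockSum_of_mem_part hY Z h.symm]
  ring

/-- `ad Y` has no blocks inside `𝔨`; the factor `2` counts `(𝔨_i, 𝔞)` together with its transpose.
-/
theorem blockSum_none_of_mem_compl {Y Z : 𝔤} (hY : Y ∈ orthCompl 𝔨) :
    A.blockSum none none Y Z = Q 𝔤 Y Z - 2 * ∑ i, A.blockSum (some i) none Y Z := by
  rw [← A.sum_sum_blockSum]
  simp only [Fintype.sum_option, A.blockSum_of_mem_compl hY, A.blockSum_symm none (some _),
    Finset.sum_const_zero, add_zero]
  ring

variable [FiniteDimensional ℝ 𝔤]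

theorem ricci_eq_sum_blockSum {g : LeftInvMetric 𝔤} {α : ℝ} {a : Fin r ⊕ Fin s → ℝ}
    (hg : D.IsDiagonal g α a) {j k : Option (Fin r ⊕ Fin s)} {Y Z : 𝔤} (hY : Y ∈ D.component j)
    (hZ : Z ∈ D.component k) :
    g.ricci Y Z = 1 / 4 * ∑ U, ∑ V, A.blockSum U V Y Z *
      ((weight α a V - weight α a U + weight α a k) * (weight α a U - weight α a V + weight α a j) /
        (weight α a U * weight α a V)) := by
  rw [g.ricci_eq_sum (p := fun x : D.Index => weight α a x.1) A.orthonormal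
    (fun x => (weight_pos hg _).ne') (fun X x => A.form_eq hg (A.basis_mem x) X)
    (A.form_eq hg hY) (A.form_eq hg hZ), Fintype.sum_sigma]
  congr 1
  refine Finset.sum_congr rfl fun U _ => ?_
  simp only [Fintype.sum_sigma]
  rw [Finset.sum_comm]
  simp only [blockSum, Finset.sum_mul]

theorem ricci_of_mem_part {g : LeftInvMetric 𝔤} {α : ℝ} {a : Fin r ⊕ Fin s → ℝ}
    (hg : D.IsDiagonal g α a) {i : Fin r ⊕ Fin s} {k : Option (Fin r ⊕ Fin s)} {Y Z : 𝔤}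
    (hY : Y ∈ D.part i) (hZ : Z ∈ D.component k) :
    g.ricci Y Z = 1 / 4 * (A.blockSum none none Y Z * (weight α a k * a i / α ^ 2) +
      A.blockSum (some i) (some i) Y Z * (weight α a k * a i / a i ^ 2)) := by
  rw [A.ricci_eq_sum_blockSum hg (j := some i) hY hZ, Fintype.sum_option,
    Finset.sum_eq_single_of_mem none (Finset.mem_univ _)
      fun V _ h => by rw [A.blockSum_of_mem_part hY Z h.symm, zero_mul],
    Finset.sum_eq_single_of_mem i (Finset.mem_univ _)
      fun j _ h => Finset.sum_eq_zero fun V _ => by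
        rw [A.blockSum_of_mem_part' hY Z h.symm V, zero_mul],
    Finset.sum_eq_single_of_mem (some i) (Finset.mem_univ _)
      fun V _ h => by rw [A.blockSum_of_mem_part hY Z h.symm, zero_mul]]
  simp only [weight, sub_self, zero_add, sq]

include A in
-- The `(𝔨_i, 𝔨_i)` block of `ad Z` vanishes, and then the `(𝔞, 𝔞)` block sum equals `Q(Y, Z) = 0`.
theorem ricci_part_eq_zero {g : LeftInvMetric 𝔤} {α : ℝ} {a : Fin r ⊕ Fin s → ℝ}
    (hg : D.IsDiagonal g α a) {i : Fin r ⊕ Fin s} {k : Option (Fin r ⊕ Fin s)} (h : k ≠ some i)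
    {Y Z : 𝔤} (hY : Y ∈ D.part i) (hZ : Z ∈ D.component k) : g.ricci Y Z = 0 := by
  have h1 : A.blockSum (some i) (some i) Y Z = 0 := by
    rw [blockSum_comm]
    rcases k with _ | k
    · exact A.blockSum_of_mem_compl hZ Y i i
    · exact A.blockSum_of_mem_part' hZ Y (fun h' => h (congrArg some h')) _
  rw [A.ricci_of_mem_part hg hY hZ, A.blockSum_none_of_mem_part hY, h1,
    D.component_orthogonal (j := some i) h.symm hY hZ]
  ring

theorem ricci_of_mem_compl {g : LeftInvMetric 𝔤} {α : ℝ} {a : Fin r ⊕ Fin s → ℝ}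
    (hg : D.IsDiagonal g α a) {Y Z : 𝔤} (hY : Y ∈ orthCompl 𝔨) (hZ : Z ∈ orthCompl 𝔨) :
    g.ricci Y Z = 1 / 4 * (Q 𝔤 Y Z + ∑ i, 2 * A.blockSum (some i) none Y Z * (1 - a i / α)) := by
  rw [A.ricci_eq_sum_blockSum hg (j := none) (k := none) hY hZ]
  have hα := hg.pos.ne'
  -- Two transposed blocks are merged. The summand split off at the end cancels the correction in
  -- `blockSum_none_of_mem_compl`, leaving `Q(Y, Z)`.
  have h1 : ∀ i, A.blockSum (some i) none Y Z * ((a i - α + α) * (α - a i + α) / (α * a i)) +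
      A.blockSum (some i) none Y Z * ((α - a i + α) * (a i - α + α) / (a i * α)) =
      2 * A.blockSum (some i) none Y Z * (1 - a i / α) + 2 * A.blockSum (some i) none Y Z := by
    intro i
    have := (hg.pos' i).ne'
    field_simp
    ring
  simp only [Fintype.sum_option, A.blockSum_of_mem_compl hY, A.blockSum_symm none (some _),
    Finset.sum_const_zero, add_zero, zero_mul, weight]
  rw [add_assoc, ← Finset.sum_add_distrib, Finset.sum_congr rfl fun i _ => h1 i,
    Finset.sum_add_distrib, A.blockSum_none_of_mem_compl hY, ← Finset.mul_sum]
  have h2 : (α - α + α) * (α - α + α) / (α * α) = 1 := by field_simp; ring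
  rw [h2]
  ring

end AdaptedBasis
end Splitting

/-- Schur's lemma for symmetric bilinear forms: if every eigenspace of `H` relative to the inner
product `B` is trivial, then `H` is a multiple of `B`. -/
theorem exists_eq_smul_of_ker_eq {M : Type*} [AddCommGroup M] [Module ℝ M]
    [FiniteDimensional ℝ M] {B H : LinearMap.BilinForm ℝ M} (hB : ∀ X Y, B X Y = B Y X)
    (hpos : ∀ X, X ≠ 0 → 0 < B X X) (hH : ∀ X Y, H X Y = H Y X)
    (hker : ∀ c : ℝ, LinearMap.ker (H - c • B) = ⊥ ∨ LinearMap.ker (H - c • B) = ⊤) :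
    ∃ c : ℝ, H = c • B := by
  rcases subsingleton_or_nontrivial M with hM | hM
  · exact ⟨0, LinearMap.ext fun X => LinearMap.ext fun Y => by
      rw [Subsingleton.elim X 0]; simp⟩
  obtain ⟨b, hb⟩ := exists_orthonormal_basis hB hpos
  -- The spectral theorem supplies a real eigenvalue `c` with a nonzero eigenvector, which excludes
  -- the trivial kernel.
  have hA : (Matrix.of fun x y => H (b x) (b y)).IsHermitian := by
    ext x y
    simp [hH (b x)]
  have i : Fin (Module.finrank ℝ M) := ⟨0, Module.finrank_pos⟩
  have hv := hA.mulVec_eigenvectorBasis i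
  set v := hA.eigenvectorBasis i with hvdef
  have hv0 : v ≠ 0 := hA.eigenvectorBasis.orthonormal.ne_zero i
  set c := hA.eigenvalues i
  set X : M := ∑ x, v x • b x with hX
  have hBX : ∀ y, B X (b y) = v y := fun y => by simp [hX, hb]
  have hX0 : X ≠ 0 := by
    intro h
    refine hv0 ?_
    ext y
    rw [← hBX, h]
    simp
  have hmem : X ∈ LinearMap.ker (H - c • B) := by
    rw [LinearMap.mem_ker]
    refine b.ext fun y => ?_
    have h1 := congrFun hv y
    simp only [Matrix.mulVec, dotProduct, Matrix.of_apply, Pi.smul_apply, smul_eq_mul] at h1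
    rw [LinearMap.sub_apply, LinearMap.sub_apply, LinearMap.smul_apply, LinearMap.smul_apply, hBX,
      smul_eq_mul, ← h1, LinearMap.zero_apply, sub_eq_zero, hX, map_sum, LinearMap.sum_apply]
    refine Finset.sum_congr rfl fun x _ => ?_
    rw [map_smul, LinearMap.smul_apply, smul_eq_mul, hH (b x), mul_comm]
  refine ⟨c, ?_⟩
  rcases hker c with h | h
  · rw [h, Submodule.mem_bot] at hmem
    exact absurd hmem hX0
  · exact sub_eq_zero.1 (LinearMap.ker_eq_top.1 h)

/-! ### The constants `κ_i` -/

namespace Splitting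

variable {𝔤 : Type*} [LieRing 𝔤] [LieAlgebra ℝ 𝔤]
  {𝔨 : Submodule ℝ 𝔤} {r s : ℕ} {D : Splitting 𝔨 r s}

theorem nontrivial_part (D : Splitting 𝔨 r s) (i : Fin r ⊕ Fin s) : Nontrivial (D.part i) := by
  rcases i with i | i
  · by_contra h
    rw [not_nontrivial_iff_subsingleton] at h
    exact (D.simple i).non_abelian ⟨fun _ _ => Subsingleton.elim _ _⟩
  · exact Module.nontrivial_of_finrank_pos (R := ℝ) (by rw [D.line i]; exact one_pos)

theorem d_pos (D : Splitting 𝔨 r s) [FiniteDimensional ℝ 𝔤] (i : Fin r ⊕ Fin s) :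
    0 < D.d i := by
  have := D.nontrivial_part i
  exact Nat.cast_pos.2 (Module.finrank_pos (R := ℝ) (M := D.part i))

namespace AdaptedBasis

variable (A : D.AdaptedBasis)

theorem eq_zero_of_forall {X : 𝔤} (h : ∀ x, Q 𝔤 X (A.basis x) = 0) : X = 0 := by
  by_contra h0
  refine (A.Q_pos h0).ne' ?_
  rw [linear_eq_sum A.orthonormal (Q 𝔤 X) X]
  exact Finset.sum_eq_zero fun x _ => by rw [h, zero_mul]

theorem part_orthonormal (j : Option (Fin r ⊕ Fin s)) (u v) :
    Q 𝔤 (A.part j u) (A.part j v) = if u = v then 1 else 0 := by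
  rw [← A.basis_apply, ← A.basis_apply, A.orthonormal]
  simp

theorem killingForm_part (i : Fin r ⊕ Fin s) (Y Z : D.part i) :
    killingForm ℝ (D.part i) Y Z = -A.blockSum (some i) (some i) Y Z := by
  let b : Module.Basis _ ℝ (D.part i) := A.part (some i)
  let B : LinearMap.BilinForm ℝ (D.part i) := (Q 𝔤).restrict (D.part i).toSubmodule
  have hb : ∀ u v, B (b u) (b v) = if u = v then 1 else 0 := A.part_orthonormal (some i)
  rw [killingForm_apply_apply, trace_eq_sum hb, blockSum, ← Finset.sum_neg_distrib]
  refine Finset.sum_congr rfl fun u _ => ?_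
  change Q 𝔤 ⁅(Y : 𝔤), ⁅(Z : 𝔤), (b u : 𝔤)⁆⁆ (b u : 𝔤) = _
  rw [Q_lie_left, Q_comm, neg_inj]
  have h := linear_eq_sum hb (Q 𝔤 ⁅(Y : 𝔤), (b u : 𝔤)⁆ ∘ₗ (D.part i).toSubmodule.subtype) ⁅Z, b u⁆
  refine h.trans (Finset.sum_congr rfl fun v _ => ?_)
  rw [A.basis_apply, A.basis_apply]
  rfl

include A in
-- For a simple summand, the kernel of the Killing form minus `cQ` is an ideal, so Schur's lemma
-- applies; on a central line both sides are `0`. Hence the choice in `kappa` meets its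
-- specification.
theorem exists_killingForm_eq [FiniteDimensional ℝ 𝔤] (i : Fin r ⊕ Fin s) :
    ∃ c : ℝ, ∀ X Y : D.part i, killingForm ℝ (D.part i) X Y = -c * Q 𝔤 X Y := by
  rcases i with i | i
  · have := D.simple i
    let B : LinearMap.BilinForm ℝ (D.part (Sum.inl i)) :=
      (Q 𝔤).restrict (D.part (Sum.inl i)).toSubmodule
    have hker : ∀ c : ℝ, LinearMap.ker (killingForm ℝ (D.part (Sum.inl i)) - c • B) = ⊥ ∨
        LinearMap.ker (killingForm ℝ (D.part (Sum.inl i)) - c • B) = ⊤ := by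
      intro c
      let I : LieIdeal ℝ (D.part (Sum.inl i)) :=
        { LinearMap.ker (killingForm ℝ (D.part (Sum.inl i)) -
            c • B) with
          lie_mem := by
            intro X Y hY
            have hY' := LinearMap.mem_ker.1 hY
            refine LinearMap.mem_ker.2 (LinearMap.ext fun Z => ?_)
            have h1 := LinearMap.congr_fun hY' ⁅X, Z⁆
            have h2 : Q 𝔤 ⁅X, Y⁆ Z = -Q 𝔤 Y ⁅X, Z⁆ := Q_lie_left (X : 𝔤) Y Z
            have h3 := LieModule.traceForm_apply_lie_apply' ℝ (D.part (Sum.inl i))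
              (D.part (Sum.inl i)) X Y Z
            change killingForm ℝ (D.part (Sum.inl i)) Y ⁅X, Z⁆ - c * Q 𝔤 Y ⁅X, Z⁆ = 0 at h1
            change killingForm ℝ (D.part (Sum.inl i)) ⁅X, Y⁆ Z - c * Q 𝔤 ⁅X, Y⁆ Z = 0
            rw [h2]
            change killingForm ℝ (D.part (Sum.inl i)) ⁅X, Y⁆ Z =
              -killingForm ℝ (D.part (Sum.inl i)) Y ⁅X, Z⁆ at h3
            rw [h3]
            linarith }
      rcases LieAlgebra.IsSimple.eq_bot_or_eq_top (R := ℝ) I with h | h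
      · left
        exact congrArg LieSubmodule.toSubmodule h
      · right
        exact congrArg LieSubmodule.toSubmodule h
    obtain ⟨c, hc⟩ := exists_eq_smul_of_ker_eq (M := D.part (Sum.inl i))
      (B := B)
      (H := killingForm ℝ (D.part (Sum.inl i))) (fun X Y => Q_comm _ _)
      (fun X hX => A.Q_pos fun h => hX (Subtype.ext h)) (fun X Y => LieModule.traceForm_comm ..) hker
    refine ⟨-c, fun X Y => ?_⟩
    rw [hc, neg_neg]
    rfl
  · refine ⟨0, fun X Y => ?_⟩
    rw [A.killingForm_part, A.blockSum_eq_zero, neg_zero, zero_mul]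
    intro S hS T _
    rw [D.central i _ (D.part_le _ X.2) S hS, map_zero, LinearMap.zero_apply]

theorem blockSum_part [FiniteDimensional ℝ 𝔤] {i : Fin r ⊕ Fin s} {Y Z : 𝔤} (hY : Y ∈ D.part i)
    (hZ : Z ∈ D.part i) : A.blockSum (some i) (some i) Y Z = D.κ i * Q 𝔤 Y Z := by
  have h := Classical.epsilon_spec (A.exists_killingForm_eq i) ⟨Y, hY⟩ ⟨Z, hZ⟩
  rw [A.killingForm_part] at h
  change -A.blockSum (some i) (some i) Y Z = -D.κ i * Q 𝔤 Y Z at h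
  linarith

theorem blockSum_self_nonneg (U V : Option (Fin r ⊕ Fin s)) (Y : 𝔤) : 0 ≤ A.blockSum U V Y Y :=
  Finset.sum_nonneg fun _ _ => Finset.sum_nonneg fun _ _ => mul_self_nonneg _

variable [FiniteDimensional ℝ 𝔤]

include A in
theorem κ_nonneg (i : Fin r ⊕ Fin s) : 0 ≤ D.κ i := by
  have := D.nontrivial_part i
  obtain ⟨X, hX⟩ := exists_ne (0 : D.part i)
  have h := A.blockSum_self_nonneg (some i) (some i) X
  rw [A.blockSum_part X.2 X.2] at h
  exact nonneg_of_mul_nonneg_left h (A.Q_pos fun h => hX (Subtype.ext h))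

include A in
-- For `X ∈ 𝔨_i` the `(𝔞, 𝔞)` block of `ad X` has squared norm `(1 - κ_i) Q(X, X)`. If `κ_i ≥ 1`,
-- then `[𝔨_i, 𝔞] = 0` and `𝔨_i` is a nonzero ideal of `𝔤`. Simplicity makes it all of `𝔤`, against
-- `𝔞 ≠ 0`.
theorem κ_lt_one [LieAlgebra.IsSimple ℝ 𝔤] (ha : orthCompl 𝔨 ≠ ⊥) (i : Fin r ⊕ Fin s) :
    D.κ i < 1 := by
  by_contra! hκ
  have h0 : ∀ X ∈ D.part i, ∀ v, ⁅X, A.basis ⟨none, v⟩⁆ = 0 := by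
    intro X hX v
    refine A.eq_zero_of_forall fun x => ?_
    by_cases hx : x.1 = none
    · have h1 := A.blockSum_none_of_mem_part (Z := X) hX
      rw [A.blockSum_part hX hX] at h1
      have h2 : 0 ≤ Q 𝔤 X X := by
        by_cases h : X = 0
        · simp [h]
        · exact (A.Q_pos h).le
      have h3 : A.blockSum none none X X = 0 :=
        le_antisymm (by nlinarith) (A.blockSum_self_nonneg _ _ _)
      rw [blockSum, Finset.sum_eq_zero_iff_of_nonneg
        fun _ _ => Finset.sum_nonneg fun _ _ => mul_self_nonneg _] at h3
      have h4 := h3 v (Finset.mem_univ _)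
      rw [Finset.sum_eq_zero_iff_of_nonneg fun _ _ => mul_self_nonneg _] at h4
      obtain ⟨j, w⟩ := x
      subst hx
      exact mul_self_eq_zero.1 (h4 w (Finset.mem_univ _))
    · exact A.Q_lie_part_eq_zero (Ne.symm hx) hX (A.basis_mem ⟨none, v⟩) (A.basis_mem x)
  let I : LieIdeal ℝ 𝔤 :=
    { (D.part i).toSubmodule with
      lie_mem := by
        intro Y X hX
        have h : (⊤ : Submodule ℝ 𝔤) ≤
            (D.part i).toSubmodule.comap (LieAlgebra.ad ℝ 𝔤 X : 𝔤 →ₗ[ℝ] 𝔤) := by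
          rw [← A.basis.span_eq, Submodule.span_le]
          rintro _ ⟨⟨j, v⟩, rfl⟩
          change ⁅X, A.basis ⟨j, v⟩⁆ ∈ D.part i
          rcases j with _ | j
          · rw [h0 X hX]
            exact zero_mem _
          · rw [← lie_skew]
            exact neg_mem (A.lie_mem (A.basis_mem ⟨some j, v⟩) hX)
        have h1 : ⁅X, Y⁆ ∈ D.part i := h (Submodule.mem_top (x := Y))
        change ⁅Y, X⁆ ∈ D.part i
        rw [← lie_skew]
        exact neg_mem h1 }
  rcases LieAlgebra.IsSimple.eq_bot_or_eq_top (R := ℝ) I with h | h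
  · have := D.nontrivial_part i
    obtain ⟨X, hX⟩ := exists_ne (0 : D.part i)
    have h1 : (X : 𝔤) ∈ I := X.2
    rw [h, LieSubmodule.mem_bot] at h1
    exact hX (Subtype.ext h1)
  · obtain ⟨Y, hY, hY0⟩ := Submodule.exists_mem_ne_zero_of_ne_bot ha
    have h1 : Y ∈ I := by rw [h]; exact LieSubmodule.mem_top Y
    exact (A.Q_pos hY0).ne' (D.component_orthogonal (j := none) (k := some i) (by simp) hY h1)

end AdaptedBasis
end Splitting

/-! ### Traces and scalar curvature of diagonal metrics -/

namespace Splitting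

variable {𝔤 : Type*} [LieRing 𝔤] [LieAlgebra ℝ 𝔤]
  {𝔨 : Submodule ℝ 𝔤} {r s : ℕ} {D : Splitting 𝔨 r s}

namespace AdaptedBasis

variable (A : D.AdaptedBasis)

theorem form_basis {T : LeftInvMetric 𝔤} {α : ℝ} {a : Fin r ⊕ Fin s → ℝ} (hT : D.IsDiagonal T α a)
    (x y : D.Index) :
    T.form (A.basis x) (A.basis y) = if x = y then weight α a x.1 else 0 := by
  rw [A.form_eq hT (A.basis_mem y), A.orthonormal]
  split_ifs with h
  · rw [h, mul_one]
  · rw [mul_zero]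

include A in
theorem finrank_eq :
    (Module.finrank ℝ 𝔤 : ℝ) = Module.finrank ℝ (orthCompl 𝔨) + ∑ i, D.d i := by
  rw [Module.finrank_eq_card_basis A.basis, Fintype.card_sigma]
  simp only [Fintype.card_fin, Fintype.sum_option]
  push_cast
  rfl

include A in
theorem exists_isDiagonal {α : ℝ} {a : Fin r ⊕ Fin s → ℝ} (hα : 0 < α) (ha : ∀ i, 0 < a i) :
    ∃ g : LeftInvMetric 𝔤, D.IsDiagonal g α a := by
  have hw : ∀ j, 0 < weight α a j := by
    rintro (_ | j)
    exacts [hα, ha j]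
  let B : LinearMap.BilinForm ℝ 𝔤 := ∑ x : D.Index, weight α a x.1 •
    LinearMap.BilinForm.linMulLin (Q 𝔤 (A.basis x)) (Q 𝔤 (A.basis x))
  have hB : ∀ X Y, B X Y =
      ∑ x : D.Index, weight α a x.1 * (Q 𝔤 (A.basis x) X * Q 𝔤 (A.basis x) Y) := by
    intro X Y
    simp [B, LinearMap.sum_apply]
  have hB' : ∀ j, ∀ X ∈ D.component j, ∀ Y, B X Y = weight α a j * Q 𝔤 X Y := by
    intro j X hX Y
    rw [hB, linear_eq_sum A.orthonormal (Q 𝔤 X) Y, Finset.mul_sum]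
    refine Finset.sum_congr rfl fun x _ => ?_
    rw [Q_comm (A.basis x) X, Q_comm (A.basis x) Y]
    by_cases h : x.1 = j
    · rw [h]
    · rw [D.component_orthogonal (Ne.symm h) hX (A.basis_mem x)]
      ring
  refine ⟨⟨B, fun X Y => ?_, fun X hX => ?_⟩, hα, ha, fun X hX Y _ => hB' none X hX Y,
    fun i X hX Y _ => hB' (some i) X hX Y, fun i X hX Y hY => ?_, fun i j h X hX Y hY => ?_⟩
  · simp only [hB, mul_comm (Q 𝔤 _ X)]
  · have h := A.Q_pos hX
    rw [linear_eq_sum A.orthonormal (Q 𝔤 X) X] at h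
    obtain ⟨x, _, hx⟩ := Finset.exists_lt_of_sum_lt
      (f := fun _ => (0 : ℝ)) (by simpa using h)
    rw [hB]
    refine Finset.sum_pos' (fun y _ => mul_nonneg (hw _).le (mul_self_nonneg _))
      ⟨x, Finset.mem_univ _, mul_pos (hw _) ?_⟩
    rwa [Q_comm (A.basis x) X]
  · rw [hB' none X hX, D.component_orthogonal (j := none) (k := some i) (by simp) hX hY, mul_zero]
  · rw [hB' (some i) X hX, D.component_orthogonal (j := some i) (k := some j) (by simpa) hX hY,
      mul_zero]

variable [FiniteDimensional ℝ 𝔤]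

theorem tr_eq_sum {g : LeftInvMetric 𝔤} {α : ℝ} {a : Fin r ⊕ Fin s → ℝ} (hg : D.IsDiagonal g α a)
    (H : LinearMap.BilinForm ℝ 𝔤) :
    g.tr H = ∑ j, (∑ u, H (A.basis ⟨j, u⟩) (A.basis ⟨j, u⟩)) / weight α a j := by
  rw [LeftInvMetric.tr, traceWrt_eq_sum_div g.nondegenerate (A.form_basis hg)
    fun x => (weight_pos hg _).ne', Fintype.sum_sigma]
  exact Finset.sum_congr rfl fun j _ => by rw [Finset.sum_div]

include A in
theorem ricci_symm {g : LeftInvMetric 𝔤} {α : ℝ} {a : Fin r ⊕ Fin s → ℝ} (hg : D.IsDiagonal g α a)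
    (Y Z : 𝔤) : g.ricci Y Z = g.ricci Z Y := by
  have h := g.ricci_eq_neg_trace (A.form_basis hg) (fun x => (weight_pos hg _).ne')
    (trace_ad_eq_zero A.orthonormal)
  rw [h, h, LinearMap.trace_comp_comm']

include A in
theorem tr_form {g T : LeftInvMetric 𝔤} {α Ta : ℝ} {a t : Fin r ⊕ Fin s → ℝ}
    (hg : D.IsDiagonal g α a) (hT : D.IsDiagonal T Ta t) :
    g.tr T.form = Module.finrank ℝ (orthCompl 𝔨) * Ta / α + ∑ i, D.d i * t i / a i := by
  rw [A.tr_eq_sum hg]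
  simp only [A.form_basis hT, if_true, Finset.sum_const, Finset.card_univ, Fintype.card_fin,
    nsmul_eq_mul, Fintype.sum_option]
  rfl

include A in
theorem trQ_form [LieAlgebra.IsSimple ℝ 𝔤] {T : LeftInvMetric 𝔤} {Ta : ℝ} {t : Fin r ⊕ Fin s → ℝ}
    (hT : D.IsDiagonal T Ta t) :
    trQ T.form = Module.finrank ℝ (orthCompl 𝔨) * Ta + ∑ i, D.d i * t i := by
  rw [trQ, traceWrt_eq_sum_div (p := fun _ => 1) Q_nondegenerate A.orthonormal
    fun _ => one_ne_zero, Fintype.sum_sigma]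
  simp only [A.form_basis hT, if_true, Finset.sum_const, Finset.card_univ, Fintype.card_fin,
    nsmul_eq_mul, Fintype.sum_option, div_one]
  rfl

include A in
theorem ricci_part_part {g : LeftInvMetric 𝔤} {α : ℝ} {a : Fin r ⊕ Fin s → ℝ}
    (hg : D.IsDiagonal g α a) {i : Fin r ⊕ Fin s} {Y Z : 𝔤} (hY : Y ∈ D.part i)
    (hZ : Z ∈ D.part i) :
    g.ricci Y Z = 1 / 4 * (D.κ i + (1 - D.κ i) * a i ^ 2 / α ^ 2) * Q 𝔤 Y Z := by
  rw [A.ricci_of_mem_part hg (k := some i) hY hZ, A.blockSum_none_of_mem_part hY,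
    A.blockSum_part hY hZ]
  have h := (hg.pos' i).ne'
  have h1 : weight α a (some i) = a i := rfl
  rw [h1]
  field_simp
  ring

theorem blockSum_none_part {i : Fin r ⊕ Fin s} {Y Z : 𝔤} (hY : Y ∈ D.part i)
    (hZ : Z ∈ D.part i) : A.blockSum none none Y Z = (1 - D.κ i) * Q 𝔤 Y Z := by
  rw [A.blockSum_none_of_mem_part hY, A.blockSum_part hY hZ]
  ring

/-- Double counting of the squares `Q([𝔨_i, 𝔞], 𝔞)²`: each basis vector of `𝔨_i` contributes `1 -
κ_i`. -/
theorem sum_blockSum_compl (i : Fin r ⊕ Fin s) :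
    ∑ u, A.blockSum (some i) none (A.basis ⟨none, u⟩) (A.basis ⟨none, u⟩) =
      D.d i * (1 - D.κ i) := by
  have h : ∑ u, A.blockSum (some i) none (A.basis ⟨none, u⟩) (A.basis ⟨none, u⟩) =
      ∑ v, A.blockSum none none (A.basis ⟨some i, v⟩) (A.basis ⟨some i, v⟩) := by
    simp only [blockSum]
    rw [Finset.sum_comm]
    refine Finset.sum_congr rfl fun v _ => Finset.sum_congr rfl fun u _ =>
      Finset.sum_congr rfl fun w _ => ?_
    rw [← lie_skew, map_neg, LinearMap.neg_apply, neg_mul_neg]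
  rw [h]
  have h1 : ∀ v, A.blockSum none none (A.basis ⟨some i, v⟩) (A.basis ⟨some i, v⟩) =
      1 - D.κ i := fun v => by
    rw [A.blockSum_none_part (A.basis_mem ⟨some i, v⟩) (A.basis_mem ⟨some i, v⟩), A.orthonormal,
      if_pos rfl, mul_one]
  simp only [h1, Finset.sum_const, Finset.card_univ, Fintype.card_fin, nsmul_eq_mul]
  rfl

include A in
-- Only traces over the summands enter, so no irreducibility is needed here. Inverse coefficients
-- are kept to match `curvatureFun`.
theorem scalarCurvature_eq {g : LeftInvMetric 𝔤} {α : ℝ} {a : Fin r ⊕ Fin s → ℝ}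
    (hg : D.IsDiagonal g α a) :
    4 * g.scalarCurvature =
      (Module.finrank ℝ (orthCompl 𝔨) + 2 * ∑ i, D.d i * (1 - D.κ i)) * α⁻¹
        + ∑ i, D.κ i * D.d i * (a i)⁻¹
        - ∑ i, D.d i * (1 - D.κ i) * (α⁻¹ ^ 2 / (a i)⁻¹) := by
  have h1 : ∑ u, g.ricci (A.basis ⟨none, u⟩) (A.basis ⟨none, u⟩) =
      1 / 4 * (Module.finrank ℝ (orthCompl 𝔨) + ∑ i, 2 * (D.d i * (1 - D.κ i)) * (1 - a i / α)) := by
    have h : ∀ u, g.ricci (A.basis ⟨none, u⟩) (A.basis ⟨none, u⟩) = _ := fun u =>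
      A.ricci_of_mem_compl hg (A.basis_mem ⟨none, u⟩) (A.basis_mem ⟨none, u⟩)
    simp only [h, A.orthonormal, if_true]
    rw [← Finset.mul_sum, Finset.sum_add_distrib, Finset.sum_comm]
    simp only [← A.sum_blockSum_compl, ← Finset.sum_mul, ← Finset.mul_sum, Finset.sum_const,
      Finset.card_univ, Fintype.card_fin, nsmul_eq_mul, mul_one]
    rfl
  have h2 : ∀ i, ∑ u, g.ricci (A.basis ⟨some i, u⟩) (A.basis ⟨some i, u⟩) =
      1 / 4 * (D.d i * (D.κ i + (1 - D.κ i) * a i ^ 2 / α ^ 2)) := by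
    intro i
    have h : ∀ u, g.ricci (A.basis ⟨some i, u⟩) (A.basis ⟨some i, u⟩) = _ := fun u =>
      A.ricci_part_part hg (A.basis_mem ⟨some i, u⟩) (A.basis_mem ⟨some i, u⟩)
    simp only [h, A.orthonormal, if_true, mul_one, Finset.sum_const, Finset.card_univ,
      Fintype.card_fin, nsmul_eq_mul]
    change D.d i * _ = _
    ring
  rw [LeftInvMetric.scalarCurvature, A.tr_eq_sum hg, Fintype.sum_option, h1]
  simp only [h2, weight]
  have hα := hg.pos.ne'
  rw [mul_add, Finset.mul_sum, add_mul, Finset.mul_sum, Finset.sum_mul, add_sub_assoc, add_assoc,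
    ← Finset.sum_sub_distrib, ← Finset.sum_add_distrib]
  have h3 : ∀ c S : ℝ, 4 * (1 / 4 * (c + S) / α) = c * α⁻¹ + S * α⁻¹ := fun c S => by
    field_simp
  rw [h3, Finset.sum_mul, add_assoc, ← Finset.sum_add_distrib]
  congr 1
  refine Finset.sum_congr rfl fun i _ => ?_
  have := (hg.pos' i).ne'
  field_simp
  ring

end AdaptedBasis
end Splitting

/-! ### Maximising the curvature function on the open simplex -/

section Optimisation

variable {ι : Type*} [Fintype ι]

/-- The scalar curvature (times four) of a diagonal metric as a function of the inverses `x`, `y i`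
of its coefficients. -/
def curvatureFun (c₀ : ℝ) (k e : ι → ℝ) (x : ℝ) (y : ι → ℝ) : ℝ :=
  c₀ * x + ∑ i, k i * y i - ∑ i, e i * (x ^ 2 / y i)

/-- The open simplex on which the trace constraint holds. -/
def openSimplex (A : ℝ) (B : ι → ℝ) : Set (ℝ × (ι → ℝ)) :=
  {p | 0 < p.1 ∧ (∀ i, 0 < p.2 i) ∧ A * p.1 + ∑ i, B i * p.2 i = 1}

variable {c₀ A μ : ℝ} {k e B : ι → ℝ}

/-- The constraint bounds `∑ k_i y_i` by `μ`, so values above `μ` must be paid for by `c₀ x`. -/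
theorem curvatureFun_le (hA : 0 < A) (hμ : 0 ≤ μ) (hk : ∀ i, k i ≤ μ * B i) {p : ℝ × (ι → ℝ)}
    (hp : p ∈ openSimplex A B) :
    curvatureFun c₀ k e p.1 p.2 ≤ c₀ * p.1 + μ - ∑ i, e i * (p.1 ^ 2 / p.2 i) := by
  obtain ⟨hx, hy, hc⟩ := hp
  have h1 : ∑ i, k i * p.2 i ≤ μ * ∑ i, B i * p.2 i := by
    rw [Finset.mul_sum]
    refine Finset.sum_le_sum fun i _ => ?_
    rw [← mul_assoc]
    exact mul_le_mul_of_nonneg_right (hk i) (hy i).le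
  have h2 : ∑ i, B i * p.2 i ≤ 1 := by nlinarith [mul_pos hA hx]
  have h3 := mul_le_mul_of_nonneg_left h2 hμ
  rw [curvatureFun]
  linarith

/-- Start at the vertex `y_m = 1/B_m`, where the function tends to `μ`, and raise the other
coordinates to `ε`. The gain is `εΔ - O(ε²)`; `e_m` reappears with a plus sign in `Δ` because
`x²/y_m` is of second order. -/
theorem exists_curvatureFun_gt [DecidableEq ι] (hA : 0 < A) (hB : ∀ i, 0 < B i) (he : ∀ i, 0 < e i)
    {m : ι} (hm : k m = μ * B m) (h : μ * (A + ∑ i, B i) < c₀ + ∑ i, k i - ∑ i, e i + e m) :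
    ∃ p ∈ openSimplex A B, μ < curvatureFun c₀ k e p.1 p.2 := by
  set S := A + ∑ i, B i with hS
  set Δ := c₀ + ∑ i, k i - ∑ i, e i + e m - μ * S with hΔ
  have hΔ0 : 0 < Δ := by linarith
  have hS0 : 0 < S := add_pos_of_pos_of_nonneg hA (Finset.sum_nonneg fun i _ => (hB i).le)
  have hem := he m
  have hBm := hB m
  -- The first bound gives `B_m η ≥ 1/2`; with it, the second makes the error `e_m ε²/η` smaller
  -- than `εΔ`.
  obtain ⟨ε, hε, hε1, hε2⟩ : ∃ ε : ℝ, 0 < ε ∧ ε * S ≤ 1 / 2 ∧ 2 * e m * B m * ε < Δ := by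
    refine ⟨min (1 / (2 * S)) (Δ / (4 * (e m * B m))), lt_min (by positivity) (by positivity),
      ?_, ?_⟩
    · calc _ ≤ 1 / (2 * S) * S := mul_le_mul_of_nonneg_right (min_le_left _ _) hS0.le
        _ = 1 / 2 := by field_simp
    · calc _ ≤ 2 * e m * B m * (Δ / (4 * (e m * B m))) :=
            mul_le_mul_of_nonneg_left (min_le_right _ _) (by positivity)
        _ = Δ / 2 := by field_simp; ring
        _ < Δ := half_lt_self hΔ0
  -- The value forced by the constraint at `x = ε`, `y_i = ε` for `i ≠ m`, `y_m = ε + η`.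
  set η := (1 - ε * S) / B m with hη
  have hBη : B m * η = 1 - ε * S := by rw [hη]; field_simp
  have hη0 : 0 < η := div_pos (by linarith) hBm
  set y : ι → ℝ := fun i => ε + if i = m then η else 0 with hy
  have hy0 : ∀ i, 0 < y i := fun i => by
    simp only [hy]
    split_ifs <;> linarith
  have hsum : ∀ w : ι → ℝ, ∑ i, w i * y i = ε * ∑ i, w i + w m * η := by
    intro w
    simp only [hy, mul_add, Finset.sum_add_distrib, mul_ite, mul_zero, Finset.sum_ite_eq',
      Finset.mem_univ, if_true, ← Finset.sum_mul]
    ring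
  refine ⟨(ε, y), ⟨hε, hy0, ?_⟩, ?_⟩
  · simp only [hsum, hBη, hS]
    ring
  · have hterm : ∀ i, e i * (ε ^ 2 / y i) ≤
        e i * ε - if i = m then e m * ε - e m * (ε ^ 2 / η) else 0 := by
      intro i
      by_cases hi : i = m
      · subst hi
        have : ε ^ 2 / y i ≤ ε ^ 2 / η :=
          div_le_div_of_nonneg_left (by positivity) hη0 (by simp only [hy, if_true]; linarith)
        rw [if_pos rfl]
        nlinarith
      · rw [if_neg hi]
        simp only [hy, if_neg hi, add_zero]
        apply le_of_eq
        field_simp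
        ring
    have h1 := Finset.sum_le_sum fun i (_ : i ∈ Finset.univ) => hterm i
    rw [Finset.sum_sub_distrib, Finset.sum_ite_eq', if_pos (Finset.mem_univ m),
      ← Finset.sum_mul] at h1
    have h2 : e m * (ε ^ 2 / η) < ε * Δ := by
      rw [← mul_div_assoc, div_lt_iff₀ hη0]
      have h3 : 1 / 2 ≤ B m * η := by linarith
      have h4 : e m * ε ≤ 2 * e m * B m * ε * η := by nlinarith [mul_pos hem hε]
      have h5 : 2 * e m * B m * ε * η < Δ * η := mul_lt_mul_of_pos_right hε2 hη0
      nlinarith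
    rw [curvatureFun]
    simp only [hsum]
    have h6 : k m * η = μ * (1 - ε * S) := by rw [hm, mul_assoc, hBη]
    rw [h6]
    have h7 : ε * Δ = c₀ * ε + ε * ∑ i, k i - (∑ i, e i) * ε + e m * ε - μ * (ε * S) := by
      rw [hΔ]; ring
    linarith

theorem exists_forall_curvatureFun_le (hA : 0 < A) (hB : ∀ i, 0 < B i) (he : ∀ i, 0 < e i)
    (hc : 0 < c₀) (hμ : 0 ≤ μ) (hk : ∀ i, k i ≤ μ * B i) {p₀ : ℝ × (ι → ℝ)}
    (hp₀ : p₀ ∈ openSimplex A B) (h₀ : μ < curvatureFun c₀ k e p₀.1 p₀.2) :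
    ∃ p ∈ openSimplex A B, ∀ q ∈ openSimplex A B,
      curvatureFun c₀ k e q.1 q.2 ≤ curvatureFun c₀ k e p.1 p.2 := by
  set f₀ := curvatureFun c₀ k e p₀.1 p₀.2 with hf₀
  -- Lower bound for `x` on the superlevel set, from `f₀ ≤ c₀ x + μ`.
  set δ := (f₀ - μ) / c₀ with hδ
  have hδ0 : 0 < δ := div_pos (by linarith) hc
  have hc₀ : 0 < c₀ / A + μ := by positivity
  -- Lower bound for `y_i`, from `e_i x²/y_i ≤ c₀/A + μ` and `x ≥ δ`.
  set δ' : ι → ℝ := fun i => e i * δ ^ 2 / (c₀ / A + μ) with hδ'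
  have hδ'0 : ∀ i, 0 < δ' i := fun i => by have := he i; positivity
  have hle : ∀ p ∈ openSimplex A B, p.1 ≤ 1 / A ∧ ∀ i, p.2 i ≤ 1 / B i := by
    rintro p ⟨hx, hy, hc⟩
    have h1 : ∀ i, 0 ≤ B i * p.2 i := fun i => (mul_pos (hB i) (hy i)).le
    refine ⟨?_, fun i => ?_⟩
    · rw [le_div_iff₀ hA]
      have := Finset.sum_nonneg fun i (_ : i ∈ Finset.univ) => h1 i
      linarith
    · rw [le_div_iff₀ (hB i)]
      have := Finset.single_le_sum (fun i _ => h1 i) (Finset.mem_univ i)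
      have := mul_pos hA hx
      linarith
  set K : Set (ℝ × (ι → ℝ)) :=
    Set.Icc (δ, δ') (1 / A, fun i => 1 / B i) ∩ {p | A * p.1 + ∑ i, B i * p.2 i = 1} with hK
  have hKsub : K ⊆ openSimplex A B := fun p hp =>
    ⟨hδ0.trans_le hp.1.1.1, fun i => (hδ'0 i).trans_le (hp.1.1.2 i), hp.2⟩
  have hKmem : ∀ p ∈ openSimplex A B, f₀ ≤ curvatureFun c₀ k e p.1 p.2 → p ∈ K := by
    intro p hp hf
    have h1 := curvatureFun_le (c₀ := c₀) (e := e) hA hμ hk hp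
    have hpos : ∀ i, 0 < e i * (p.1 ^ 2 / p.2 i) := fun i =>
      mul_pos (he i) (div_pos (pow_pos hp.1 2) (hp.2.1 i))
    have hx : δ ≤ p.1 := by
      rw [hδ, div_le_iff₀ hc]
      have := Finset.sum_nonneg fun i (_ : i ∈ Finset.univ) => (hpos i).le
      linarith
    refine ⟨⟨⟨hx, fun i => ?_⟩, ⟨(hle p hp).1, (hle p hp).2⟩⟩, hp.2.2⟩
    have h2 := Finset.single_le_sum (fun i _ => (hpos i).le) (Finset.mem_univ i)
    have h3 : c₀ * p.1 ≤ c₀ / A := by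
      have := mul_le_mul_of_nonneg_left (hle p hp).1 hc.le
      rwa [mul_one_div] at this
    have h4 : e i * (p.1 ^ 2 / p.2 i) ≤ c₀ / A + μ := by linarith
    have h5 : e i * δ ^ 2 ≤ e i * p.1 ^ 2 :=
      mul_le_mul_of_nonneg_left (pow_le_pow_left₀ hδ0.le hx 2) (he i).le
    rw [← mul_div_assoc, div_le_iff₀ (hp.2.1 i)] at h4
    change e i * δ ^ 2 / (c₀ / A + μ) ≤ p.2 i
    rw [div_le_iff₀ hc₀]
    linarith
  have hKc : IsCompact K := isCompact_Icc.inter_right (isClosed_eq (by fun_prop) (by fun_prop))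
  have hcont : ContinuousOn (fun p : ℝ × (ι → ℝ) => curvatureFun c₀ k e p.1 p.2) K := by
    unfold curvatureFun
    refine ContinuousOn.sub (by fun_prop) (continuousOn_finsetSum _ fun i _ => ?_)
    exact continuousOn_const.mul (ContinuousOn.div (by fun_prop) (by fun_prop)
      fun p hp => ((hKsub hp).2.1 i).ne')
  obtain ⟨p, hp, hmax⟩ := hKc.exists_isMaxOn ⟨p₀, hKmem p₀ hp₀ le_rfl⟩ hcont
  refine ⟨p, hKsub hp, fun q hq => ?_⟩
  by_cases h : f₀ ≤ curvatureFun c₀ k e q.1 q.2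
  · exact hmax (hKmem q hq h)
  · exact (not_le.1 h).le.trans (hmax (hKmem p₀ hp₀ le_rfl))

/-- The Lagrange multiplier of the trace constraint at a maximum is the maximal value. -/
theorem gradient_eq_of_isMax [DecidableEq ι] (hA : 0 < A) {x : ℝ} {y : ι → ℝ}
    (hp : (x, y) ∈ openSimplex A B)
    (hmax : ∀ q ∈ openSimplex A B, curvatureFun c₀ k e q.1 q.2 ≤ curvatureFun c₀ k e x y) :
    c₀ - ∑ i, e i * (2 * x / y i) = curvatureFun c₀ k e x y * A ∧
      ∀ i, k i + e i * (x ^ 2 / y i ^ 2) = curvatureFun c₀ k e x y * B i := by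
  obtain ⟨hx, hy, hc⟩ := hp
  simp only at hx hy hc
  -- The derivative vanishes along the direction with `x`-component `-B_i` and `y_i`-component `A`,
  -- which is tangent to the constraint.
  have key : ∀ i, A * (k i + e i * (x ^ 2 / y i ^ 2)) =
      B i * (c₀ - ∑ j, e j * (2 * x / y j)) := by
    intro i
    set σ : ι → ℝ := fun j => if j = i then 1 else 0 with hσ
    have hsum : ∀ w : ι → ℝ, ∑ j, w j * σ j = w i := fun w => by simp [hσ]
    have hd : HasDerivAt
        (fun ε : ℝ => curvatureFun c₀ k e (x - B i * ε) (fun j => y j + A * σ j * ε))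
        (c₀ * (-B i) + ∑ j, k j * (A * σ j) -
          ∑ j, e j * ((2 * x * (-B i) * y j - x ^ 2 * (A * σ j)) / y j ^ 2)) 0 := by
      unfold curvatureFun
      have h1 : HasDerivAt (fun ε : ℝ => x - B i * ε) (-B i) 0 := by
        simpa using ((hasDerivAt_id (0 : ℝ)).const_mul (B i)).const_sub x
      have h2 : ∀ j, HasDerivAt (fun ε : ℝ => y j + A * σ j * ε) (A * σ j) 0 := fun j => by
        simpa using ((hasDerivAt_id (0 : ℝ)).const_mul (A * σ j)).const_add (y j)
      refine ((h1.const_mul c₀).add (HasDerivAt.fun_sum fun j _ => (h2 j).const_mul (k j))).sub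
        (HasDerivAt.fun_sum fun j _ => HasDerivAt.const_mul (e j) ?_)
      have h3 := (h1.fun_pow 2).fun_div (h2 j) (by simpa using (hy j).ne')
      simpa using h3
    have hloc : IsLocalMax
        (fun ε : ℝ => curvatureFun c₀ k e (x - B i * ε) (fun j => y j + A * σ j * ε)) 0 := by
      have e1 : ∀ᶠ ε : ℝ in nhds 0, 0 < x - B i * ε :=
        ContinuousAt.eventually_lt (by fun_prop) (by fun_prop) (by simpa using hx)
      have e2 : ∀ᶠ ε : ℝ in nhds 0, ∀ j, 0 < y j + A * σ j * ε :=
        Filter.eventually_all.2 fun j =>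
          ContinuousAt.eventually_lt (by fun_prop) (by fun_prop) (by simpa using hy j)
      filter_upwards [e1, e2] with ε h1 h2
      have := hmax (x - B i * ε, fun j => y j + A * σ j * ε) ⟨h1, h2, ?_⟩
      · simpa using this
      · have h3 : ∑ j, B j * (y j + A * σ j * ε) = ∑ j, B j * y j + A * ε * ∑ j, B j * σ j := by
          rw [Finset.mul_sum, ← Finset.sum_add_distrib]
          exact Finset.sum_congr rfl fun j _ => by ring
        simp only [h3, hsum]
        linarith
    have h0 := hloc.hasDerivAt_eq_zero hd
    have h1 : ∑ j, k j * (A * σ j) = A * k i := by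
      rw [← hsum k, Finset.mul_sum]
      exact Finset.sum_congr rfl fun j _ => by ring
    have h2 : ∑ j, e j * ((2 * x * (-B i) * y j - x ^ 2 * (A * σ j)) / y j ^ 2) =
        -B i * ∑ j, e j * (2 * x / y j) - A * (e i * (x ^ 2 / y i ^ 2)) := by
      rw [← hsum fun j => e j * (x ^ 2 / y j ^ 2), Finset.mul_sum, Finset.mul_sum,
        ← Finset.sum_sub_distrib]
      refine Finset.sum_congr rfl fun j _ => ?_
      have := (hy j).ne'
      field_simp
    rw [h1, h2] at h0
    linarith
  -- Euler's identity for a function homogeneous of degree one, combined with `key` and the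
  -- constraint.
  have euler : A * curvatureFun c₀ k e x y = c₀ - ∑ j, e j * (2 * x / y j) := by
    have h1 : curvatureFun c₀ k e x y = x * (c₀ - ∑ j, e j * (2 * x / y j)) +
        ∑ j, y j * (k j + e j * (x ^ 2 / y j ^ 2)) := by
      rw [curvatureFun, mul_sub, Finset.mul_sum, add_sub_assoc, sub_add_eq_add_sub, add_sub_assoc,
        ← Finset.sum_sub_distrib, ← Finset.sum_sub_distrib, mul_comm]
      congr 1
      refine Finset.sum_congr rfl fun j _ => ?_
      have := (hy j).ne'
      field_simp
      ring
    have h2 : A * ∑ j, y j * (k j + e j * (x ^ 2 / y j ^ 2)) =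
        (∑ j, B j * y j) * (c₀ - ∑ j, e j * (2 * x / y j)) := by
      rw [Finset.mul_sum, Finset.sum_mul]
      refine Finset.sum_congr rfl fun j _ => ?_
      linear_combination y j * key j
    rw [h1, mul_add, h2]
    linear_combination (c₀ - ∑ j, e j * (2 * x / y j)) * hc
  refine ⟨by rw [← euler, mul_comm], fun i => ?_⟩
  have := key i
  rw [← euler] at this
  have h2 : A * (k i + e i * (x ^ 2 / y i ^ 2)) = A * (curvatureFun c₀ k e x y * B i) := by
    rw [this]; ring
  exact mul_left_cancel₀ hA.ne' h2

end Optimisation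

/-! ### Casimir forms of the summands and Schur's lemma on `𝔞` -/

section Restrict

variable {𝔤 : Type*} [LieRing 𝔤] [LieAlgebra ℝ 𝔤] [FiniteDimensional ℝ 𝔤]

theorem exists_linearEquiv_restrict (φ : 𝔤 ≃ₗ⁅ℝ⁆ 𝔤) {V : Submodule ℝ 𝔤}
    (h : ∀ X ∈ V, φ X ∈ V) : ∃ e : V ≃ₗ[ℝ] V, ∀ X : V, (e X : 𝔤) = φ X :=
  ⟨LinearEquiv.ofInjectiveEndo ((φ : 𝔤 →ₗ[ℝ] 𝔤).restrict h) fun _ _ hXY =>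
    Subtype.ext (φ.injective (congrArg Subtype.val hXY)), fun _ => rfl⟩

end Restrict

namespace Splitting

variable {𝔤 : Type*} [LieRing 𝔤] [LieAlgebra ℝ 𝔤]
  {𝔨 : Submodule ℝ 𝔤} {r s : ℕ} {D : Splitting 𝔨 r s}

namespace AdaptedBasis

variable (A : D.AdaptedBasis)

/-- The form `(Y, Z) ↦ ∑ Q([b, Y], [b, Z])`, where `b` runs over an orthonormal basis of `𝔨_i`. -/
def casimirForm (i : Fin r ⊕ Fin s) : LinearMap.BilinForm ℝ 𝔤 :=
  ∑ u, (Q 𝔤).comp (LieAlgebra.ad ℝ 𝔤 (A.part (some i) u)) (LieAlgebra.ad ℝ 𝔤 (A.part (some i) u))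

theorem casimirForm_apply (i : Fin r ⊕ Fin s) (Y Z : 𝔤) :
    A.casimirForm i Y Z =
      ∑ u, Q 𝔤 ⁅(A.part (some i) u : 𝔤), Y⁆ ⁅(A.part (some i) u : 𝔤), Z⁆ := by
  simp [casimirForm, LinearMap.sum_apply, LinearMap.BilinForm.comp_apply]

theorem casimirForm_symm (i : Fin r ⊕ Fin s) (Y Z : 𝔤) :
    A.casimirForm i Y Z = A.casimirForm i Z Y := by
  rw [casimirForm_apply, casimirForm_apply]
  exact Finset.sum_congr rfl fun _ _ => Q_comm _ _

/-- Since `[Y, 𝔨_i] ⊂ 𝔞`, Parseval over `𝔞` alone already gives the full `Q`-product. -/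
theorem blockSum_eq_casimirForm (i : Fin r ⊕ Fin s) {Y : 𝔤} (hY : Y ∈ orthCompl 𝔨) (Z : 𝔤) :
    A.blockSum (some i) none Y Z = A.casimirForm i Y Z := by
  rw [blockSum, casimirForm_apply]
  refine Finset.sum_congr rfl fun u _ => ?_
  have h : ∀ X, Q 𝔤 ⁅X, Y⁆ ⁅X, Z⁆ = Q 𝔤 ⁅Y, X⁆ ⁅Z, X⁆ := fun X => by
    rw [← lie_skew X Y, ← lie_skew X Z, map_neg, map_neg, LinearMap.neg_apply, neg_neg]
  rw [← A.basis_apply (some i) u, h, linear_eq_sum A.orthonormal (Q 𝔤 ⁅Y, _⁆), Fintype.sum_sigma,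
    Fintype.sum_option, left_eq_add]
  refine Finset.sum_eq_zero fun j _ => Finset.sum_eq_zero fun v _ => ?_
  rw [A.Q_lie_compl_eq_zero hY (A.basis_mem ⟨some i, u⟩) (A.basis_mem ⟨some j, v⟩), zero_mul]

variable [FiniteDimensional ℝ 𝔤]

/-- `φ` preserves `Q` and carries the orthonormal basis of `𝔨_i` to another one, on which the sum
does not depend. -/
theorem casimirForm_equiv (φ : 𝔤 ≃ₗ⁅ℝ⁆ 𝔤) {i : Fin r ⊕ Fin s} (h : ∀ X ∈ D.part i, φ X ∈ D.part i)
    (Y Z : 𝔤) : A.casimirForm i (φ Y) (φ Z) = A.casimirForm i Y Z := by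
  obtain ⟨e, he⟩ := exists_linearEquiv_restrict φ (V := D.component (some i)) h
  let H : LinearMap.BilinForm ℝ (D.component (some i)) :=
    (Q 𝔤).compl₁₂ ((LieAlgebra.ad ℝ 𝔤 : 𝔤 →ₗ[ℝ] 𝔤 →ₗ[ℝ] 𝔤).flip (φ Y) ∘ₗ Submodule.subtype _)
      ((LieAlgebra.ad ℝ 𝔤 : 𝔤 →ₗ[ℝ] 𝔤 →ₗ[ℝ] 𝔤).flip (φ Z) ∘ₗ Submodule.subtype _)
  have hH : ∀ S T : D.component (some i), H S T = Q 𝔤 ⁅(S : 𝔤), φ Y⁆ ⁅(T : 𝔤), φ Z⁆ :=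
    fun _ _ => rfl
  have h1 := sum_bilin_eq_sum_bilin (B := (Q 𝔤).restrict (D.component (some i)))
    (fun _ _ => Q_comm _ _) (A.part_orthonormal (some i)) (b' := (A.part (some i)).map e)
    (fun u v => by
      rw [Module.Basis.map_apply, Module.Basis.map_apply]
      change Q 𝔤 (e _ : 𝔤) (e _ : 𝔤) = _
      rw [he, he, Q_equiv, A.part_orthonormal]) H
  simp only [hH, Module.Basis.map_apply, he, ← LieEquiv.map_lie, Q_equiv] at h1
  rw [casimirForm_apply, casimirForm_apply, h1]

/-- Every eigenspace of the Casimir form on `𝔞` is invariant under the `φ k`, hence trivial. This is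
where irreducibility, beyond `𝔞 ≠ 0`, enters. -/
theorem exists_casimirForm_eq {κ : Type*} (φ : κ → 𝔤 ≃ₗ⁅ℝ⁆ 𝔤)
    (hφ : ∀ k, ∀ X ∈ orthCompl 𝔨, φ k X ∈ orthCompl 𝔨)
    (hirr : ∀ W ≤ orthCompl 𝔨, (∀ k, ∀ X ∈ W, φ k X ∈ W) → W = ⊥ ∨ W = orthCompl 𝔨)
    {i : Fin r ⊕ Fin s} (h : ∀ k, ∀ X ∈ D.part i, φ k X ∈ D.part i) :
    ∃ c : ℝ, ∀ Y ∈ orthCompl 𝔨, ∀ Z ∈ orthCompl 𝔨, A.casimirForm i Y Z = c * Q 𝔤 Y Z := by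
  let B : LinearMap.BilinForm ℝ (orthCompl 𝔨) := (Q 𝔤).restrict (orthCompl 𝔨)
  let H : LinearMap.BilinForm ℝ (orthCompl 𝔨) := (A.casimirForm i).restrict (orthCompl 𝔨)
  have hker : ∀ c : ℝ, LinearMap.ker (H - c • B) = ⊥ ∨ LinearMap.ker (H - c • B) = ⊤ := by
    intro c
    have hinj := Submodule.map_injective_of_injective (orthCompl 𝔨).injective_subtype
    have hinv : ∀ k, ∀ X ∈ (LinearMap.ker (H - c • B)).map (orthCompl 𝔨).subtype,
        φ k X ∈ (LinearMap.ker (H - c • B)).map (orthCompl 𝔨).subtype := by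
      rintro k _ ⟨X, hX, rfl⟩
      obtain ⟨e, he⟩ := exists_linearEquiv_restrict (φ k) (hφ k)
      refine ⟨e X, LinearMap.mem_ker.2 (LinearMap.ext fun Y => ?_), he X⟩
      have h1 := LinearMap.congr_fun (LinearMap.mem_ker.1 hX) (e.symm Y)
      change A.casimirForm i X (e.symm Y : orthCompl 𝔨) - c * Q 𝔤 X (e.symm Y : orthCompl 𝔨) = 0
        at h1
      change A.casimirForm i (e X : orthCompl 𝔨) Y - c * Q 𝔤 (e X : orthCompl 𝔨) Y = 0
      rw [← A.casimirForm_equiv (φ k) (h k), ← Q_equiv (φ k), ← he, ← he,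
        LinearEquiv.apply_symm_apply] at h1
      exact h1
    rcases hirr _ (Submodule.map_subtype_le _ _) hinv with h0 | h0
    · left
      exact hinj (by rw [h0, Submodule.map_bot])
    · right
      exact hinj (by rw [h0, Submodule.map_subtype_top])
  obtain ⟨c, hc⟩ := exists_eq_smul_of_ker_eq (B := B) (H := H) (fun _ _ => Q_comm _ _)
    (fun X hX => A.Q_pos fun h => hX (Subtype.ext h)) (fun _ _ => A.casimirForm_symm i _ _) hker
  exact ⟨c, fun Y hY Z hZ => LinearMap.congr_fun (LinearMap.congr_fun hc ⟨Y, hY⟩) ⟨Z, hZ⟩⟩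

theorem finrank_mul_blockSum {i : Fin r ⊕ Fin s} {c : ℝ}
    (hc : ∀ Y ∈ orthCompl 𝔨, ∀ Z ∈ orthCompl 𝔨, A.casimirForm i Y Z = c * Q 𝔤 Y Z) :
    Module.finrank ℝ (orthCompl 𝔨) * c = D.d i * (1 - D.κ i) := by
  have h : ∀ u, A.blockSum (some i) none (A.basis ⟨none, u⟩) (A.basis ⟨none, u⟩) = c := fun u => by
    have hu : A.basis ⟨none, u⟩ ∈ orthCompl 𝔨 := A.basis_mem ⟨none, u⟩
    rw [A.blockSum_eq_casimirForm i hu, hc _ hu _ hu, A.orthonormal, if_pos rfl, mul_one]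
  rw [← A.sum_blockSum_compl]
  simp only [h, Finset.sum_const, Finset.card_univ, Fintype.card_fin, nsmul_eq_mul]
  rfl

end AdaptedBasis

variable [FiniteDimensional ℝ 𝔤]

/-- Four times the scalar curvature, as a function of the inverses of the coefficients. -/
def scalFun (D : Splitting 𝔨 r s) (x : ℝ) (y : Fin r ⊕ Fin s → ℝ) : ℝ :=
  curvatureFun (Module.finrank ℝ (orthCompl 𝔨) + 2 * ∑ i, D.d i * (1 - D.κ i))
    (fun i => D.κ i * D.d i) (fun i => D.d i * (1 - D.κ i)) x y

/-- The inverses of the coefficients of the constrained diagonal metrics. -/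
def constraintSet (D : Splitting 𝔨 r s) (Ta : ℝ) (t : Fin r ⊕ Fin s → ℝ) :
    Set (ℝ × (Fin r ⊕ Fin s → ℝ)) :=
  openSimplex (Module.finrank ℝ (orthCompl 𝔨) * Ta) fun i => D.d i * t i

/-! ### From the optimisation problem back to metrics -/

section Assembly

variable {T : LeftInvMetric 𝔤} {Ta : ℝ} {t : Fin r ⊕ Fin s → ℝ}

theorem IsDiagonal.mem_constraintSet (hT : D.IsDiagonal T Ta t) {g : LeftInvMetric 𝔤} {α : ℝ}
    {a : Fin r ⊕ Fin s → ℝ} (hg : D.IsDiagonal g α a) (h : g.tr T.form = 1) :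
    (α⁻¹, fun i => (a i)⁻¹) ∈ D.constraintSet Ta t := by
  obtain ⟨A⟩ := hT.nonempty_adaptedBasis
  refine ⟨inv_pos.2 hg.pos, fun i => inv_pos.2 (hg.pos' i), ?_⟩
  rw [A.tr_form hg hT] at h
  simpa only [div_eq_mul_inv] using h

theorem IsDiagonal.scalarCurvature_eq {g : LeftInvMetric 𝔤} {α : ℝ} {a : Fin r ⊕ Fin s → ℝ}
    (hg : D.IsDiagonal g α a) : 4 * g.scalarCurvature = D.scalFun α⁻¹ fun i => (a i)⁻¹ := by
  obtain ⟨A⟩ := hg.nonempty_adaptedBasis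
  exact A.scalarCurvature_eq hg

/-- Together with `IsDiagonal.mem_constraintSet`, this lets maxima pass between metrics and points
of the simplex. -/
theorem IsDiagonal.exists_metric (hT : D.IsDiagonal T Ta t) {p : ℝ × (Fin r ⊕ Fin s → ℝ)}
    (hp : p ∈ D.constraintSet Ta t) :
    ∃ g ∈ D.constrainedMetrics T, 4 * g.scalarCurvature = D.scalFun p.1 p.2 := by
  obtain ⟨A⟩ := hT.nonempty_adaptedBasis
  obtain ⟨g, hg⟩ := A.exists_isDiagonal (inv_pos.2 hp.1) (a := fun i => (p.2 i)⁻¹)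
    fun i => inv_pos.2 (hp.2.1 i)
  refine ⟨g, ⟨⟨_, _, hg⟩, ?_⟩, ?_⟩
  · rw [A.tr_form hg hT]
    simpa only [div_eq_mul_inv, inv_inv] using hp.2.2
  · rw [hg.scalarCurvature_eq]
    simp only [inv_inv]

theorem finrank_orthCompl_pos (ha : orthCompl 𝔨 ≠ ⊥) :
    (0 : ℝ) < Module.finrank ℝ (orthCompl 𝔨) :=
  Nat.cast_pos.2 (Submodule.one_le_finrank_iff.2 ha)

variable [LieAlgebra.IsSimple ℝ 𝔤]

/-- In `exists_curvatureFun_gt`, `A + ∑ B_i` is `tr_Q T`, and `c₀ + ∑ k_i - ∑ e_i + e_m` is `d + d_m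
- κ_m d_m` because `k_i + e_i = d_i`. -/
theorem IsDiagonal.exists_scalFun_gt (hT : D.IsDiagonal T Ta t) (ha : orthCompl 𝔨 ≠ ⊥)
    {m : Fin r ⊕ Fin s} (hineq : D.κ m * trQ T.form / t m <
      Module.finrank ℝ 𝔤 + D.d m - D.κ m * D.d m) :
    ∃ p ∈ D.constraintSet Ta t, D.κ m / t m < D.scalFun p.1 p.2 := by
  obtain ⟨A⟩ := hT.nonempty_adaptedBasis
  refine exists_curvatureFun_gt (mul_pos (finrank_orthCompl_pos ha) hT.pos)
    (fun i => mul_pos (D.d_pos i) (hT.pos' i))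
    (fun i => mul_pos (D.d_pos i) (sub_pos.2 (A.κ_lt_one ha i))) (m := m) ?_ ?_
  · have := (hT.pos' m).ne'
    field_simp
  · rw [A.trQ_form hT, A.finrank_eq, mul_div_right_comm] at hineq
    have h : ∑ i, D.d i * (1 - D.κ i) + ∑ i, D.κ i * D.d i = ∑ i, D.d i := by
      rw [← Finset.sum_add_distrib]
      exact Finset.sum_congr rfl fun i _ => by ring
    linarith

/-- Existence of a diagonal metric of maximal scalar curvature. -/
theorem IsDiagonal.exists_isMax (hT : D.IsDiagonal T Ta t) (ha : orthCompl 𝔨 ≠ ⊥)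
    {m : Fin r ⊕ Fin s} (hm : ∀ i, D.κ i / t i ≤ D.κ m / t m)
    (hineq : D.κ m * trQ T.form / t m < Module.finrank ℝ 𝔤 + D.d m - D.κ m * D.d m) :
    ∃ g ∈ D.constrainedMetrics T, ∀ g' ∈ D.constrainedMetrics T,
      g'.scalarCurvature ≤ g.scalarCurvature := by
  obtain ⟨A⟩ := hT.nonempty_adaptedBasis
  obtain ⟨p₀, hp₀, h₀⟩ := hT.exists_scalFun_gt ha hineq
  have hd := finrank_orthCompl_pos ha
  have he : ∀ i, 0 < D.d i * (1 - D.κ i) := fun i =>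
    mul_pos (D.d_pos i) (sub_pos.2 (A.κ_lt_one ha i))
  obtain ⟨p, hp, hmax⟩ := exists_forall_curvatureFun_le (mul_pos hd hT.pos)
    (fun i => mul_pos (D.d_pos i) (hT.pos' i)) he
    (add_pos_of_pos_of_nonneg hd
      (mul_nonneg zero_le_two (Finset.sum_nonneg fun i _ => (he i).le)))
    (div_nonneg (A.κ_nonneg m) (hT.pos' m).le)
    (fun i => by
      have h1 := (div_le_iff₀ (hT.pos' i)).1 (hm i)
      have h2 := mul_le_mul_of_nonneg_right h1 (D.d_pos i).le
      calc _ ≤ _ := h2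
        _ = _ := by ring) hp₀ h₀
  obtain ⟨g, hg, hgS⟩ := hT.exists_metric hp
  refine ⟨g, hg, fun g' hg' => ?_⟩
  obtain ⟨⟨α, a, hd'⟩, htr⟩ := hg'
  have h1 := hmax _ (hT.mem_constraintSet hd' htr)
  have h2 := hd'.scalarCurvature_eq
  rw [scalFun] at hgS h2
  linarith

/-- If an irreducible group action preserves all the summands, then a diagonal metric of maximal
scalar curvature has Ricci curvature proportional to `T`. -/
theorem IsDiagonal.ricci_eq_of_isMax (hT : D.IsDiagonal T Ta t) (ha : orthCompl 𝔨 ≠ ⊥)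
    {m : Fin r ⊕ Fin s}
    (hineq : D.κ m * trQ T.form / t m < Module.finrank ℝ 𝔤 + D.d m - D.κ m * D.d m)
    {κ : Type*} (φ : κ → 𝔤 ≃ₗ⁅ℝ⁆ 𝔤) (hφ : ∀ k, ∀ X ∈ orthCompl 𝔨, φ k X ∈ orthCompl 𝔨)
    (hirr : ∀ W ≤ orthCompl 𝔨, (∀ k, ∀ X ∈ W, φ k X ∈ W) → W = ⊥ ∨ W = orthCompl 𝔨)
    (hpart : ∀ k i, ∀ X ∈ D.part i, φ k X ∈ D.part i) {g : LeftInvMetric 𝔤}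
    (hg : g ∈ D.constrainedMetrics T)
    (hmax : ∀ g' ∈ D.constrainedMetrics T, g'.scalarCurvature ≤ g.scalarCurvature) :
    ∃ c : ℝ, 0 < c ∧ g.ricci = c • T.form := by
  obtain ⟨A⟩ := hT.nonempty_adaptedBasis
  obtain ⟨⟨α, a, hgd⟩, htr⟩ := hg
  have hS := hgd.scalarCurvature_eq
  have hmax' : ∀ q ∈ D.constraintSet Ta t,
      D.scalFun q.1 q.2 ≤ D.scalFun α⁻¹ fun i => (a i)⁻¹ := by
    intro q hq
    obtain ⟨g', hg', h'⟩ := hT.exists_metric hq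
    rw [← h', ← hS]
    linarith [hmax g' hg']
  have hd := finrank_orthCompl_pos ha
  obtain ⟨hgrad, hgrad'⟩ := gradient_eq_of_isMax (mul_pos hd hT.pos)
    (hT.mem_constraintSet hgd htr) hmax'
  change _ - ∑ i, D.d i * (1 - D.κ i) * (2 * α⁻¹ / (a i)⁻¹) = D.scalFun _ _ * _ at hgrad
  set F := D.scalFun α⁻¹ fun i => (a i)⁻¹ with hF
  have hα := hgd.pos
  -- The maximum exceeds `κ_m/T_m ≥ 0`, which makes the Ricci constant positive.
  have hF0 : 0 < F := by
    obtain ⟨p, hp, h⟩ := hT.exists_scalFun_gt ha hineq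
    exact ((div_nonneg (A.κ_nonneg m) (hT.pos' m).le).trans_lt h).trans_le (hmax' p hp)
  refine ⟨F / 4, by positivity, ?_⟩
  choose c hc using fun i => A.exists_casimirForm_eq φ hφ hirr fun k => hpart k i
  have hcd : ∀ i, Module.finrank ℝ (orthCompl 𝔨) * c i = D.d i * (1 - D.κ i) := fun i =>
    A.finrank_mul_blockSum (hc i)
  have hcompl : ∀ Y ∈ orthCompl 𝔨, ∀ Z ∈ orthCompl 𝔨, g.ricci Y Z = F / 4 * (Ta * Q 𝔤 Y Z) := by
    intro Y hY Z hZ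
    rw [A.ricci_of_mem_compl hgd hY hZ]
    have h1 : ∀ i, 2 * A.blockSum (some i) none Y Z * (1 - a i / α) =
        (2 * c i - c i * (2 * α⁻¹ / (a i)⁻¹)) * Q 𝔤 Y Z := by
      intro i
      have := (hgd.pos' i).ne'
      rw [A.blockSum_eq_casimirForm i hY, hc i Y hY Z hZ]
      field_simp
    -- The `x`-component of the gradient equation divided by `dim 𝔞`, using `hcd`.
    have h2 : 1 + ∑ i, (2 * c i - c i * (2 * α⁻¹ / (a i)⁻¹)) = F * Ta := by
      refine mul_left_cancel₀ hd.ne' ?_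
      simp only [← hcd] at hgrad
      rw [Finset.sum_sub_distrib, ← Finset.mul_sum]
      simp only [mul_assoc, ← Finset.mul_sum] at hgrad
      linear_combination hgrad
    simp only [h1]
    rw [← Finset.sum_mul]
    linear_combination (1 / 4 * Q 𝔤 Y Z) * h2
  have hpart' : ∀ i, ∀ Y ∈ D.part i, ∀ Z ∈ D.part i,
      g.ricci Y Z = F / 4 * (t i * Q 𝔤 Y Z) := by
    intro i Y hY Z hZ
    rw [A.ricci_part_part hgd hY hZ]
    have h1 : D.κ i * D.d i + D.d i * (1 - D.κ i) * (α⁻¹ ^ 2 / (a i)⁻¹ ^ 2) = F * (D.d i * t i) :=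
      hgrad' i
    -- The `y_i`-component divided by `d_i`.
    have h2 : D.κ i + (1 - D.κ i) * a i ^ 2 / α ^ 2 = F * t i := by
      refine mul_left_cancel₀ (D.d_pos i).ne' ?_
      have := (hgd.pos' i).ne'
      have h3 : α⁻¹ ^ 2 / (a i)⁻¹ ^ 2 = a i ^ 2 / α ^ 2 := by field_simp
      rw [h3] at h1
      linear_combination h1
    rw [h2]
    ring
  refine A.basis.ext fun x => A.basis.ext fun y => ?_
  have hx := A.basis_mem x
  have hy := A.basis_mem y
  rw [LinearMap.smul_apply, LinearMap.smul_apply, smul_eq_mul, A.form_eq hT hy]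
  generalize A.basis x = X at hx
  generalize A.basis y = Y at hy
  generalize x.1 = j at hx
  generalize y.1 = l at hy
  by_cases hjl : j = l
  · subst hjl
    rcases j with _ | i
    · exact hcompl X hx Y hy
    · exact hpart' i X hx Y hy
  · rw [D.component_orthogonal hjl hx hy, mul_zero, mul_zero]
    rcases j with _ | i
    · rcases l with _ | l
      · exact absurd rfl hjl
      · rw [A.ricci_symm hgd]
        exact A.ricci_part_eq_zero hgd (k := none) hjl hy hx
    · exact A.ricci_part_eq_zero hgd (Ne.symm hjl) hx hy

end Assembly
end Splitting

end NaturallyReductive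

end

open NaturallyReductive in
theorem theorem3p2
    {E : Type*} [NormedAddCommGroup E] [NormedSpace ℝ E] [FiniteDimensional ℝ E]
    {G : Type*} [TopologicalSpace G] [ChartedSpace E G] [Group G] [LieGroup 𝓘(ℝ, E) ∞ G]
    [T2Space G] [CompactSpace G] [LieAlgebra.IsSimple ℝ (LieAlg E G)]
    {F : Type*} [NormedAddCommGroup F] [NormedSpace ℝ F] [FiniteDimensional ℝ F]
    {K : Type*} [TopologicalSpace K] [ChartedSpace F K] [Group K] [LieGroup 𝓘(ℝ, F) ∞ K]
    [T2Space K] [CompactSpace K]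
    (ι : K →* G) (hι : ContMDiff 𝓘(ℝ, F) 𝓘(ℝ, E) ∞ ι) (hinj : Function.Injective ι)
    (hirr : AdIrreducible ι (orthCompl (subAlg E F ι)))
    {r s : ℕ} (D : Splitting (subAlg E F ι) r s)
    (T : LeftInvMetric (LieAlg E G)) (Ta : ℝ) (t : Fin r ⊕ Fin s → ℝ)
    (hT : D.IsDiagonal T Ta t)
    (m : Fin r ⊕ Fin s) (hm : ∀ i, D.κ i / t i ≤ D.κ m / t m)
    (hineq : D.κ m * trQ T.form / t m <
      Module.finrank ℝ (LieAlg E G) + D.d m - D.κ m * D.d m) :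
    (∃ g ∈ D.constrainedMetrics T, ∀ g' ∈ D.constrainedMetrics T,
      g'.scalarCurvature ≤ g.scalarCurvature) ∧
    ((∀ k i, ∀ X ∈ D.part i, Ad (ι k) X ∈ D.part i) →
      ∀ g ∈ D.constrainedMetrics T,
        (∀ g' ∈ D.constrainedMetrics T, g'.scalarCurvature ≤ g.scalarCurvature) →
        ∃ c : ℝ, 0 < c ∧ g.ricci = c • T.form) :=
  ⟨hT.exists_isMax hirr.1 hm hineq, fun hpart _ hg hmax =>
    hT.ricci_eq_of_isMax hirr.1 hineq (fun k => AdEquiv (ι k)) hirr.2.1 hirr.2.2 hpart hg hmax⟩
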